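/- Let $K$ be an algebraically closed field of characteristic $0$, let $G$ be a linear algebraic group over $K$ with Lie algebra $\mathfrak g$, and let $\mathfrak a=\bigoplus_i\mathfrak a_i$ be a finite-dimensional $\mathbb Z/m$-graded ($m\ge 2$) or $\mathbb Z$-graded vector space whose graded pieces are rational $G$-modules, with $\mathfrak a_0=\mathfrak g$ (the adjoint module) and $M=\mathfrak a_1$. Suppose $\mathfrak a$ carries a bilinear, $G$-invariant bracket with $[\mathfrak a_i,\mathfrak a_j]\subseteq\mathfrak a_{i+j}$ which agrees with the $\mathfrak g$-action on $\mathfrak g$ and on $M$: $[\cdot,\cdot]$ restricted to $\mathfrak g\times\mathfrak g$ is the Lie bracket of $\mathfrak g$, and $[X,S]=X.S=-[S,X]$ for $X\in\mathfrak g$, $S\in M$. (Neither global skew-symmetry nor the Jacobi identity is assumed.) For $T\in M$ let $B_{101}(T)\colon\mathfrak a_0\to\mathfrak a_1$ be the block of $\operatorname{ad}_T=[T,\cdot]$ from $\mathfrak a_0$ to $\mathfrak a_1$. For a subset $X\subseteq M$ let $\mathbb P(X)\subseteq\mathbb P(M)$ be the Zariski closure of the image of $X\setminus\{0\}$ in $\mathbb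 P(M)$; $\dim$ is the dimension in the Zariski topology. Let $0\neq T\in M$. If the orbit $G.T\subset M$ is conical, i.e. stable under multiplication by nonzero scalars, then $$\operatorname{rank} B_{101}(T)=\dim\mathbb P(\overline{G.T})+1 .$$ If $G.T$ is not conical, then $$\operatorname{rank} B_{101}(T)=\dim\mathbb P(\overline{G.T}) .$$ -/

import Mathlib

open scoped TensorProduct LinearAlgebra.Projectivization

noncomputable section

namespace AdjointRank

/-! ### Linear algebraic groups, their Lie algebras and their modules

A linear algebraic group `G` over an algebraically closed field `K` is given by its coordinate ring
`A = K[G]`, a reduced commutative Hopf algebra of finite type over `K`. -/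

section Group

variable (K A : Type*) [Field K] [CommRing A] [HopfAlgebra K A]

/-- The group `G` of (closed) points of the linear algebraic group with coordinate ring `A`;
the group law is the convolution product, i.e. `(g * h)(f) = (g ⊗ h)(Δ f)`. -/
abbrev Points : Type _ := WithConv (A →ₐ[K] K)

/-- A point of `G`, seen as the evaluation functional on the coordinate ring. -/
def Points.ev {K A : Type*} [Field K] [CommRing A] [HopfAlgebra K A] (g : Points K A) :
    WithConv (A →ₗ[K] K) :=
  WithConv.toConv g.ofConv.toLinearMap

/-- The Lie algebra `𝔤 = T₁G` of `G`: the point derivations of `K[G]` at the identity element. -/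
def lieAlg : Submodule K (WithConv (A →ₗ[K] K)) where
  carrier := {X | ∀ a b : A, X (a * b) =
    Coalgebra.counit (R := K) a * X b + X a * Coalgebra.counit (R := K) b}
  zero_mem' := by intro a b; simp
  add_mem' := by
    intro X Y hX hY a b
    have h1 := hX a b
    have h2 := hY a b
    simp only [WithConv.ofConv_add, LinearMap.add_apply] at *
    rw [h1, h2]; ring
  smul_mem' := by
    intro c X hX a b
    have h1 := hX a b
    simp only [WithConv.ofConv_smul, LinearMap.smul_apply, smul_eq_mul] at *
    rw [h1]; ring

variable {K A}

/-- Compatibility of a convolution product with products in `A`, on the level of `A ⊗ A`. -/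
theorem conv_deriv {φ ψ φ' ψ' : WithConv (A →ₗ[K] K)}
    (h : ∀ a b, φ (a * b) = φ' a * φ b + φ a * φ' b)
    (h' : ∀ a b, ψ (a * b) = ψ' a * ψ b + ψ a * ψ' b) (a b : A) :
    (φ * ψ) (a * b) = (φ' * ψ') a * (φ * ψ) b + (φ' * ψ) a * (φ * ψ') b +
      (φ * ψ') a * (φ' * ψ) b + (φ * ψ) a * (φ' * ψ') b := by
  simp only [LinearMap.convMul_apply, Bialgebra.comul_mul]
  generalize Coalgebra.comul (R := K) a = u
  generalize Coalgebra.comul (R := K) b = v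
  induction u using TensorProduct.induction_on with
  | zero => simp
  | add x y hx hy => simp only [add_mul, map_add, hx, hy]; ring
  | tmul x y =>
    induction v using TensorProduct.induction_on with
    | zero => simp
    | add z w hz hw => simp only [mul_add, map_add, hz, hw]; ring
    | tmul z w =>
      simp only [Algebra.TensorProduct.tmul_mul_tmul, TensorProduct.map_tmul,
        LinearMap.mul'_apply, h, h']
      ring

/-- Twisted version of `conv_deriv` with a multiplicative left factor. -/
theorem conv_mul_deriv (g : Points K A) {ψ ψ' : WithConv (A →ₗ[K] K)}
    (h' : ∀ a b, ψ (a * b) = ψ' a * ψ b + ψ a * ψ' b) (a b : A) :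
    (g.ev * ψ) (a * b) = (g.ev * ψ') a * (g.ev * ψ) b + (g.ev * ψ) a * (g.ev * ψ') b := by
  have h : ∀ a b, g.ev (a * b) = g.ev a * g.ev b := fun a b => map_mul g.ofConv a b
  simp only [LinearMap.convMul_apply, Bialgebra.comul_mul]
  generalize Coalgebra.comul (R := K) a = u
  generalize Coalgebra.comul (R := K) b = v
  induction u using TensorProduct.induction_on with
  | zero => simp
  | add x y hx hy => simp only [add_mul, map_add, hx, hy]; ring
  | tmul x y =>
    induction v using TensorProduct.induction_on with
    | zero => simp
    | add z w hz hw => simp only [mul_add, map_add, hz, hw]; ring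
    | tmul z w =>
      simp only [Algebra.TensorProduct.tmul_mul_tmul, TensorProduct.map_tmul,
        LinearMap.mul'_apply, h, h']
      ring

/-- Twisted version of `conv_deriv` with a multiplicative right factor. -/
theorem conv_deriv_mul (g : Points K A) {ψ ψ' : WithConv (A →ₗ[K] K)}
    (h' : ∀ a b, ψ (a * b) = ψ' a * ψ b + ψ a * ψ' b) (a b : A) :
    (ψ * g.ev) (a * b) = (ψ' * g.ev) a * (ψ * g.ev) b + (ψ * g.ev) a * (ψ' * g.ev) b := by
  have h : ∀ a b, g.ev (a * b) = g.ev a * g.ev b := fun a b => map_mul g.ofConv a b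
  simp only [LinearMap.convMul_apply, Bialgebra.comul_mul]
  generalize Coalgebra.comul (R := K) a = u
  generalize Coalgebra.comul (R := K) b = v
  induction u using TensorProduct.induction_on with
  | zero => simp
  | add x y hx hy => simp only [add_mul, map_add, hx, hy]; ring
  | tmul x y =>
    induction v using TensorProduct.induction_on with
    | zero => simp
    | add z w hz hw => simp only [mul_add, map_add, hz, hw]; ring
    | tmul z w =>
      simp only [Algebra.TensorProduct.tmul_mul_tmul, TensorProduct.map_tmul,
        LinearMap.mul'_apply, h, h']
      ring

theorem mem_lieAlg_iff {X : WithConv (A →ₗ[K] K)} : X ∈ lieAlg K A ↔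
    ∀ a b : A, X (a * b) = (1 : WithConv (A →ₗ[K] K)) a * X b +
      X a * (1 : WithConv (A →ₗ[K] K)) b := by
  simp only [LinearMap.convOne_apply, Algebra.algebraMap_self, RingHom.id_apply]
  exact Iff.rfl

/-- The Lie bracket `X * Y - Y * X` of `𝔤` (commutator for the convolution product). -/
def lieBr (X Y : lieAlg K A) : lieAlg K A :=
  ⟨X.1 * Y.1 - Y.1 * X.1, by
    rw [mem_lieAlg_iff]
    intro a b
    have h1 := conv_deriv (mem_lieAlg_iff.1 X.2) (mem_lieAlg_iff.1 Y.2) a b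
    have h2 := conv_deriv (mem_lieAlg_iff.1 Y.2) (mem_lieAlg_iff.1 X.2) a b
    simp only [one_mul, mul_one] at h1 h2
    simp only [WithConv.ofConv_sub, LinearMap.sub_apply]
    rw [h1, h2]
    ring⟩

/-- The adjoint action `Ad g X = g * X * g⁻¹` of `G` on `𝔤`. -/
def Ad (g : Points K A) (X : lieAlg K A) : lieAlg K A :=
  ⟨g.ev * X.1 * (g⁻¹).ev, by
    have h := conv_deriv_mul g⁻¹ (conv_mul_deriv g (mem_lieAlg_iff.1 X.2))
    have h1 : g.ev * 1 * (g⁻¹).ev = 1 := by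
      rw [mul_one]
      exact congrArg Points.ev (mul_inv_cancel g)
    rw [h1] at h
    exact mem_lieAlg_iff.2 h⟩

end Group

/-- A `G`-module (rational representation of `G`): a comodule over the coordinate ring of `G`. -/
structure GModule (K A W : Type*) [Field K] [CommRing A] [HopfAlgebra K A]
    [AddCommGroup W] [Module K W] where
  /-- the coaction; `coact w = ∑ wᵢ ⊗ aᵢ` means `g • w = ∑ aᵢ(g) wᵢ` -/
  coact : W →ₗ[K] W ⊗[K] A
  coassoc : (TensorProduct.assoc K W A A).toLinearMap ∘ₗ coact.rTensor A ∘ₗ coact =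
    (Coalgebra.comul (R := K) (A := A)).lTensor W ∘ₗ coact
  counit : (TensorProduct.rid K W).toLinearMap ∘ₗ
    (Coalgebra.counit (R := K) (A := A)).lTensor W ∘ₗ coact = LinearMap.id

namespace GModule

variable {K A W : Type*} [Field K] [CommRing A] [HopfAlgebra K A] [AddCommGroup W] [Module K W]
  (R : GModule K A W)

/-- The action of a functional `φ` on `K[G]`: if `coact w = ∑ wᵢ ⊗ aᵢ` then
`R.contract φ w = ∑ φ(aᵢ) wᵢ`. -/
def contract (φ : WithConv (A →ₗ[K] K)) : W →ₗ[K] W :=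
  (TensorProduct.rid K W).toLinearMap ∘ₗ φ.ofConv.lTensor W ∘ₗ R.coact

theorem contract_one : R.contract 1 = LinearMap.id := by
  have h : (1 : WithConv (A →ₗ[K] K)).ofConv = Coalgebra.counit (R := K) (A := A) := by
    ext a; simp [LinearMap.convOne_def]
  rw [contract, h, R.counit]

theorem contract_mul (φ ψ : WithConv (A →ₗ[K] K)) :
    R.contract (φ * ψ) = R.contract φ ∘ₗ R.contract ψ := by
  have key : ∀ z : W ⊗[K] (A ⊗[K] A),
      TensorProduct.rid K W ((LinearMap.mul' K K ∘ₗ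
        TensorProduct.map φ.ofConv ψ.ofConv).lTensor W z) =
      TensorProduct.rid K W (φ.ofConv.lTensor W (TensorProduct.rid K (W ⊗[K] A)
        (ψ.ofConv.lTensor (W ⊗[K] A) ((TensorProduct.assoc K W A A).symm z)))) := by
    intro z
    induction z using TensorProduct.induction_on with
    | zero => simp
    | add x y hx hy => simp only [map_add, hx, hy]
    | tmul w y =>
      induction y using TensorProduct.induction_on with
      | zero => simp
      | add x y hx hy => simp only [map_add, TensorProduct.tmul_add, hx, hy]
      | tmul a b => simp [smul_smul, mul_comm]
  have key2 : ∀ z : W ⊗[K] A, TensorProduct.rid K (W ⊗[K] A)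
      (ψ.ofConv.lTensor (W ⊗[K] A) (R.coact.rTensor A z)) =
      R.coact (TensorProduct.rid K W (ψ.ofConv.lTensor W z)) := by
    intro z
    induction z using TensorProduct.induction_on with
    | zero => simp
    | add x y hx hy => simp only [map_add, hx, hy]
    | tmul w a => simp
  ext w
  have hco := LinearMap.congr_fun R.coassoc w
  simp only [LinearMap.comp_apply, LinearEquiv.coe_coe] at hco
  have h1 : R.contract (φ * ψ) w = TensorProduct.rid K W ((LinearMap.mul' K K ∘ₗ
        TensorProduct.map φ.ofConv ψ.ofConv).lTensor W
          ((Coalgebra.comul (R := K) (A := A)).lTensor W (R.coact w))) := by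
    rw [← LinearMap.comp_apply (LinearMap.lTensor W _), ← LinearMap.lTensor_comp]
    rfl
  rw [h1, key, ← hco, LinearEquiv.symm_apply_apply, key2]
  rfl

/-- The linear representation of the group `G` on `W`. -/
def rep : Representation K (Points K A) W where
  toFun g := R.contract g.ev
  map_one' := R.contract_one
  map_mul' g h := R.contract_mul g.ev h.ev

/-- The differentiated action of `𝔤` on `W`. -/
def lieAct (X : lieAlg K A) : W →ₗ[K] W := R.contract X.1

end GModule

/-! ### Graded algebras extending a `G`-module -/

/-- A `ZMod m`-graded algebra `𝔞 = ⨁ᵢ 𝒜 i` (for `m = 0`, a `ℤ`-graded one) with `𝒜 0 = 𝔤`, with a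
`G`-invariant bilinear bracket that respects the grading and agrees with the `𝔤`-action on `𝔤` and
on `M = 𝒜 1`. Neither skew-symmetry on all of `𝔞` nor the Jacobi identity is required. -/
structure GradedExtension (K A : Type*) [Field K] [CommRing A] [HopfAlgebra K A] {m : ℕ}
    {𝔞 : Type*} [AddCommGroup 𝔞] [Module K 𝔞] (𝒜 : ZMod m → Submodule K 𝔞) where
  /-- the `G`-module structure of `𝔞` -/
  gmod : GModule K A 𝔞
  /-- each graded piece is a `G`-submodule -/
  stable : ∀ (g : Points K A) (i : ZMod m), ∀ x ∈ 𝒜 i, gmod.rep g x ∈ 𝒜 i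
  /-- the identification of `𝔤` with the piece of degree zero -/
  ident : lieAlg K A ≃ₗ[K] 𝒜 0
  ident_Ad : ∀ (g : Points K A) (X : lieAlg K A), (ident (Ad g X) : 𝔞) = gmod.rep g (ident X)
  /-- the bilinear bracket, i.e. the structure tensor `B` -/
  bracket : 𝔞 →ₗ[K] 𝔞 →ₗ[K] 𝔞
  bracket_mem : ∀ (i j : ZMod m), ∀ x ∈ 𝒜 i, ∀ y ∈ 𝒜 j, bracket x y ∈ 𝒜 (i + j)
  bracket_invariant : ∀ (g : Points K A) (x y : 𝔞),
    gmod.rep g (bracket x y) = bracket (gmod.rep g x) (gmod.rep g y)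
  bracket_lie : ∀ X Y : lieAlg K A, bracket (ident X) (ident Y) = ident (lieBr X Y)
  bracket_left : ∀ (X : lieAlg K A), ∀ x ∈ 𝒜 1, bracket (ident X) x = gmod.lieAct X x
  bracket_right : ∀ (X : lieAlg K A), ∀ x ∈ 𝒜 1, bracket x (ident X) = -gmod.lieAct X x

namespace GradedExtension

variable {K A : Type*} [Field K] [CommRing A] [HopfAlgebra K A] {m : ℕ}
  {𝔞 : Type*} [AddCommGroup 𝔞] [Module K 𝔞] {𝒜 : ZMod m → Submodule K 𝔞}
  [DirectSum.Decomposition 𝒜] (E : GradedExtension K A 𝒜)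

/-- The block `B_{ijk}(a) : 𝒜 j → 𝒜 k` of the adjoint operator `ad a = [a, ·]` of `a ∈ 𝒜 i`. -/
def block (i j k : ZMod m) (a : 𝒜 i) : 𝒜 j →ₗ[K] 𝒜 k :=
  DirectSum.component K (ZMod m) (fun l => 𝒜 l) k ∘ₗ
    (DirectSum.decomposeLinearEquiv 𝒜).toLinearMap ∘ₗ E.bracket a ∘ₗ (𝒜 j).subtype

/-- The orbit `G.T ⊆ M` of `T ∈ M = 𝒜 1`. -/
def orbit (T : 𝒜 1) : Set (𝒜 1) := {w | ∃ g : Points K A, (w : 𝔞) = E.gmod.rep g T}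

end GradedExtension

/-! ### Zariski topologies and dimension -/

section Zariski

variable (K W : Type*) [Field K] [AddCommGroup W] [Module K W]

/-- A subset of a vector space is conical if it is stable under multiplication by nonzero scalars. -/
def IsConical {K W : Type*} [Field K] [AddCommGroup W] [Module K W] (X : Set W) : Prop :=
  ∀ c : K, c ≠ 0 → ∀ x ∈ X, c • x ∈ X

/-- The Zariski topology on a finite-dimensional vector space `W`, with basis the sets `p ≠ 0` for
`p` a polynomial in the linear forms on `W`. -/
abbrev zariski : TopologicalSpace W :=
  TopologicalSpace.generateFrom {U | ∃ p : MvPolynomial (Module.Dual K W) K,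
    U = {w | MvPolynomial.eval (fun ξ : Module.Dual K W => ξ w) p ≠ 0}}

/-- The Zariski topology on the projective space `ℙ(W)`, with basis the sets `p ≠ 0` for `p` a
homogeneous polynomial in the linear forms on `W`. -/
abbrev projZariski : TopologicalSpace (ℙ K W) :=
  TopologicalSpace.generateFrom {U | ∃ (n : ℕ) (p : MvPolynomial (Module.Dual K W) K),
    p.IsHomogeneous n ∧ U = {x | MvPolynomial.eval (fun ξ : Module.Dual K W => ξ x.rep) p ≠ 0}}

variable {W}

/-- The Zariski closure of a subset of a vector space. -/
def zariskiClosure (X : Set W) : Set W := @closure W (zariski K W) X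

/-- The projective variety `ℙ(X) ⊆ ℙ(W)` of a subset `X ⊆ W`: the Zariski closure of the image of
`X \ {0}` under the projection `W \ {0} → ℙ(W)`. -/
def projVariety (X : Set W) : Set (ℙ K W) :=
  @closure _ (projZariski K W) {x | ∃ (w : W) (hw : w ≠ 0), w ∈ X ∧ x = Projectivization.mk K w hw}

/-- The dimension of a subset of `ℙ(W)`: its Krull dimension in the Zariski topology. -/
def projDim (Y : Set (ℙ K W)) : WithBot ℕ∞ :=
  @topologicalKrullDim Y (@instTopologicalSpaceSubtype _ _ (projZariski K W))

end Zariski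

end AdjointRank

end

/-! Since `[T, X] = -X.T`, the block has range `𝔤.T`. In a basis of `M` with `T = e_o`, the group
acts by a matrix `ρ` of regular functions and `𝔤.T` becomes `lieVec K ρ o`. Two facts give the
claim: the projective orbit closure has the dimension of the image of `𝔤.T` in `M / K T`, and `T ∈
𝔤.T` exactly when the orbit is conical.

For the dimension, let `L` be the localization of `K[G]` at a minimal prime, a field because `K[G]`
is reduced. The ratios `ρ_io / ρ_co` in `L` are the generic point of a piece of an affine chart,
whose dimension in characteristic zero is the rank of the values of the derivations of `L` there
(`ringKrullDim_quotient_ker_aeval`). Logarithmic derivatives `u⁻¹ D(u)` lie in `𝔤 ⊗ L`, and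
invariant derivations extend to `L`; so these values form the image of `𝔤.T ⊗ L` under a map whose
kernel is the line of `e_o` (`range_evalDer_chart`). The number is the same for every component, and
`projDim_eq` assembles the charts.

For the conical criterion, consider the character `ρ_oo` on the stabilizer of the line `K T`. If it
takes all nonzero values, it is transcendental modulo some prime, and a derivation with `D t = t`
has a logarithmic derivative fixing `e_o` (`single_mem_lieVec`). If `X.T = T`, the invariant
derivation of `X` forces the character to be transcendental, hence to take almost all values, and
products of two values fill `Kˣ` (`exists_point_of_single_mem_lieVec`). -/

noncomputable section

namespace AdjointRank

/-! ### Points of finitely generated algebras -/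

section Points

variable {K B : Type*} [Field K] [IsAlgClosed K] [CommRing B] [Algebra K B] [Algebra.FiniteType K B]

/-- Weak Nullstellensatz: a nonzero algebra of finite type has a `K`-point. -/
theorem nonempty_algHom [Nontrivial B] : Nonempty (B →ₐ[K] K) := by
  obtain ⟨M, hM⟩ := Ideal.exists_maximal B
  let := Ideal.Quotient.field M
  have : Module.Finite K (B ⧸ M) := finite_of_finite_type_of_isJacobsonRing K (B ⧸ M)
  have : Algebra.IsAlgebraic K (B ⧸ M) := inferInstance
  exact ⟨(IsAlgClosed.lift (R := K) (S := B ⧸ M) (M := K)).comp (Ideal.Quotient.mkₐ K M)⟩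

/-- A proper ideal of an algebra of finite type has a zero. -/
theorem exists_algHom_le_ker {I : Ideal B} (hI : I ≠ ⊤) : ∃ φ : B →ₐ[K] K, ∀ a ∈ I, φ a = 0 := by
  have := Ideal.Quotient.nontrivial_iff.2 hI
  obtain ⟨φ⟩ := nonempty_algHom (K := K) (B := B ⧸ I)
  refine ⟨φ.comp (Ideal.Quotient.mkₐ K I), fun a ha => ?_⟩
  have : Ideal.Quotient.mkₐ K I a = 0 := Ideal.Quotient.eq_zero_iff_mem.2 ha
  rw [AlgHom.comp_apply, this, map_zero]

/-- A function vanishing at all points is nilpotent. -/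
theorem isNilpotent_of_forall_algHom {a : B} (h : ∀ φ : B →ₐ[K] K, φ a = 0) : IsNilpotent a := by
  by_contra hn
  -- Rabinowitsch trick: a point of the localization is a point of `B` at which `a` is a unit.
  have : Nontrivial (Localization.Away a) := by
    by_contra hs
    rw [not_nontrivial_iff_subsingleton] at hs
    exact hn (by simpa [Submonoid.mem_powers_iff, IsNilpotent] using
      (IsLocalization.subsingleton_iff (S := Localization.Away a) (M := Submonoid.powers a)).1 hs)
  have : Algebra.FinitePresentation B (Localization.Away a) :=
    IsLocalization.Away.finitePresentation a
  have : Algebra.FiniteType K (Localization.Away a) := Algebra.FiniteType.trans ‹_› inferInstance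
  obtain ⟨φ⟩ := nonempty_algHom (K := K) (B := Localization.Away a)
  have hu : IsUnit (φ (algebraMap B _ a)) :=
    (IsLocalization.Away.algebraMap_isUnit (S := Localization.Away a) a).map φ
  have h0 := h (φ.comp (IsScalarTower.toAlgHom K B (Localization.Away a)))
  simp only [AlgHom.comp_apply, IsScalarTower.coe_toAlgHom'] at h0
  rw [h0] at hu
  exact not_isUnit_zero hu

theorem eq_zero_of_forall_algHom [IsReduced B] {a : B} (h : ∀ φ : B →ₐ[K] K, φ a = 0) : a = 0 :=
  (isNilpotent_of_forall_algHom h).eq_zero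

end Points

/-! ### Krull dimension of integral extensions -/

/-- Incomparability makes contraction of primes strictly monotone; lying over for the head of a
chain, together with going up, lifts chains. -/
theorem ringKrullDim_eq_of_isIntegral {R S : Type*} [CommRing R] [CommRing S] [Algebra R S]
    [Algebra.IsIntegral R S] (hinj : Function.Injective (algebraMap R S)) :
    ringKrullDim S = ringKrullDim R := by
  apply le_antisymm
  · refine Order.krullDim_le_of_strictMono (PrimeSpectrum.comap (algebraMap R S)) fun p q hpq => ?_
    obtain ⟨x, hxq, hxp⟩ := SetLike.exists_of_lt (show p.asIdeal < q.asIdeal from hpq)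
    exact Ideal.comap_lt_comap_of_integral_mem_sdiff (le_of_lt (show p.asIdeal < q.asIdeal from hpq))
      ⟨hxq, hxp⟩ (Algebra.IsIntegral.isIntegral x)
  · refine iSup_le fun l => ?_
    obtain ⟨Q, -, hQ, hQl⟩ := Ideal.exists_ideal_over_prime_of_isIntegral (S := S) l.head.asIdeal ⊥
      (by rw [← RingHom.ker_eq_comap_bot, (RingHom.injective_iff_ker_eq_bot _).1 hinj]
          exact bot_le)
    have : Q.LiesOver l.head.asIdeal := ⟨hQl.symm⟩
    obtain ⟨M, hM, -⟩ := Ideal.exists_ltSeries_of_hasGoingUp l Q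
    rw [← hM]
    exact le_iSup (fun M : LTSeries (PrimeSpectrum S) => (M.length : WithBot ℕ∞)) M

/-! ### Derivations in characteristic zero -/

section Derivations

variable {K : Type*} [Field K]

/-- Derivations extend along formally smooth algebras. -/
theorem exists_derivation_extension {P L : Type*} [CommRing P] [Field L] [Algebra K P] [Algebra K L]
    [Algebra P L] [IsScalarTower K P L] [Algebra.FormallySmooth P L] (d : Derivation K P L) :
    ∃ D : Derivation K L L, ∀ p, D (algebraMap P L p) = d p := by
  -- Formal smoothness kills `H1Cotangent`, so `L ⊗ Ω[P⁄K] → Ω[L⁄K]` is injective; over the field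
  -- `L` it then has a retraction, along which `d` extends.
  have hinj : Function.Injective (KaehlerDifferential.mapBaseChange K P L) := by
    rw [injective_iff_map_eq_zero]
    intro x hx
    obtain ⟨y, rfl⟩ := (Algebra.H1Cotangent.exact_δ_mapBaseChange K P L x).1 hx
    have := Algebra.FormallySmooth.subsingleton_h1Cotangent (R := P) (A := L)
    rw [Subsingleton.elim y 0, map_zero]
  obtain ⟨r, hr⟩ := LinearMap.exists_leftInverse_of_injective
    (KaehlerDifferential.mapBaseChange K P L) (LinearMap.ker_eq_bot.2 hinj)
  let φ : L ⊗[P] Ω[P⁄K] →ₗ[L] L := LinearMap.liftBaseChange L d.liftKaehlerDifferential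
  refine ⟨(φ ∘ₗ r).compDer (KaehlerDifferential.D K L), fun p => ?_⟩
  have h1 : KaehlerDifferential.D K L (algebraMap P L p) =
      KaehlerDifferential.mapBaseChange K P L (1 ⊗ₜ KaehlerDifferential.D K P p) := by
    simp
  have h2 := LinearMap.congr_fun hr (1 ⊗ₜ KaehlerDifferential.D K P p)
  simp only [LinearMap.comp_apply, LinearMap.id_apply] at h2
  change φ (r (KaehlerDifferential.D K L (algebraMap P L p))) = d p
  rw [h1, h2]
  simp [φ]

/-- In characteristic zero, derivations with prescribed values at algebraically independent
elements exist. -/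
theorem exists_derivation_of_algebraicIndependent {L ι : Type*} [Field L] [Algebra K L] [CharZero K]
    [Algebra.EssFiniteType K L] {z : ι → L} (hz : AlgebraicIndependent K z) (v : ι → L) :
    ∃ D : Derivation K L L, ∀ i, D (z i) = v i := by
  let : Algebra (MvPolynomial ι K) L := (MvPolynomial.aeval z).toAlgebra
  have hmap : ∀ p, algebraMap (MvPolynomial ι K) L p = MvPolynomial.aeval z p := fun _ => rfl
  have : IsScalarTower K (MvPolynomial ι K) L := .of_algebraMap_eq fun x => by simp [hmap]
  have hfs : FaithfulSMul (MvPolynomial ι K) L := (faithfulSMul_iff_algebraMap_injective _ _).2 hz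
  let F := FractionRing (MvPolynomial ι K)
  let : Algebra F L := FractionRing.liftAlgebra (MvPolynomial ι K) L
  have : IsScalarTower (MvPolynomial ι K) F L := inferInstance
  have : IsScalarTower K F L := .of_algebraMap_eq fun x => by
    rw [IsScalarTower.algebraMap_apply K (MvPolynomial ι K) L,
      IsScalarTower.algebraMap_apply (MvPolynomial ι K) F L,
      ← IsScalarTower.algebraMap_apply K (MvPolynomial ι K) F]
  -- A finitely generated field extension in characteristic zero is formally smooth, and `F` is a
  -- localization of the polynomial ring, so the composite is formally smooth.
  have : Algebra.EssFiniteType F L := Algebra.EssFiniteType.of_comp K F L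
  have : CharZero F := charZero_of_injective_algebraMap (algebraMap K F).injective
  have : Algebra.FormallySmooth F L := inferInstance
  have : Algebra.FormallyEtale (MvPolynomial ι K) F :=
    Algebra.FormallyEtale.of_isLocalization (nonZeroDivisors (MvPolynomial ι K))
  have : Algebra.FormallySmooth (MvPolynomial ι K) L := Algebra.FormallySmooth.comp _ F L
  obtain ⟨D, hD⟩ := exists_derivation_extension (MvPolynomial.mkDerivation K v)
  refine ⟨D, fun i => ?_⟩
  have := hD (MvPolynomial.X i)
  rwa [hmap, MvPolynomial.aeval_X, MvPolynomial.mkDerivation_X] at this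

/-- The values of the derivations of `L` at a family of elements. -/
def evalDer (K : Type*) [Field K] {L n : Type*} [Field L] [Algebra K L] (y : n → L) :
    Derivation K L L →ₗ[L] (n → L) where
  toFun D i := D (y i)
  map_add' _ _ := rfl
  map_smul' _ _ := rfl

/-- The field of constants of a derivation. -/
def constants {L : Type*} [Field L] [Algebra K L] (D : Derivation K L L) :
    IntermediateField K L where
  carrier := {x | D x = 0}
  mul_mem' {a b} ha hb := by
    simp only [Set.mem_ofPred_eq] at *; rw [D.leibniz, ha, hb, smul_zero, smul_zero, add_zero]
  add_mem' {a b} ha hb := by simp only [Set.mem_ofPred_eq] at *; rw [map_add, ha, hb, add_zero]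
  algebraMap_mem' r := D.map_algebraMap r
  inv_mem' a ha := by
    simp only [Set.mem_ofPred_eq] at *; rw [D.leibniz_inv, ha, smul_zero]

/-- In characteristic zero a derivation killing a subring kills the elements integral over it. -/
theorem derivation_eq_zero_of_isIntegral {L P : Type*} [Field L] [Algebra K L] [CharZero K]
    [CommRing P] [Algebra P L] (D : Derivation K L L)
    (hD : ∀ p, D (algebraMap P L p) = 0) {x : L} (hx : IsIntegral P x) : D x = 0 := by
  have hx' : IsIntegral (constants D) x := by
    obtain ⟨p, hp, hpx⟩ := hx
    let φ : P →+* constants D := (algebraMap P L).codRestrict (constants D) hD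
    refine ⟨p.map φ, hp.map φ, ?_⟩
    rw [Polynomial.eval₂_map]
    exact hpx
  let D' : Derivation (constants D) L L := Derivation.mk'
    { toFun := D
      map_add' := map_add D
      map_smul' := fun c y => by
        have hc : D (c : L) = 0 := c.2
        simp [Algebra.smul_def, D.leibniz, IntermediateField.algebraMap_apply, hc] }
    (fun a b => D.leibniz a b)
  have : CharZero (constants D) :=
    charZero_of_injective_algebraMap (algebraMap K (constants D)).injective
  -- Expanding gives `μ'(x) * D x = 0` for the minimal polynomial `μ`, which is separable in
  -- characteristic zero.
  have h0 : D' (Polynomial.aeval x (minpoly (constants D) x)) = 0 := by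
    rw [minpoly.aeval, map_zero]
  rw [Derivation.map_aeval] at h0
  have hs := (minpoly.irreducible hx').separable.aeval_derivative_ne_zero
    (minpoly.aeval (constants D) x)
  exact (smul_eq_zero.1 h0).resolve_left hs

theorem derivation_aeval_eq_zero {L m : Type*} [Field L] [Algebra K L] {w : m → L}
    {D : Derivation K L L} (hw : ∀ i, D (w i) = 0) (p : MvPolynomial m K) :
    D (MvPolynomial.aeval w p) = 0 := by
  have : MvPolynomial.aeval w p ∈ constants D := by
    induction p using MvPolynomial.induction_on with
    | C a => simp
    | add p q hp hq => rw [map_add]; exact add_mem hp hq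
    | mul_X p i hp => rw [map_mul, MvPolynomial.aeval_X]; exact mul_mem hp (hw i)
  exact this

/-- The transcendence degree of `K(y)`, hence the dimension of the affine variety with generic
point `y`, is the rank of the values at `y` of the derivations. -/
theorem ringKrullDim_quotient_ker_aeval [CharZero K] {L n : Type*} [Field L] [Algebra K L]
    [Algebra.EssFiniteType K L] [Finite n] (y : n → L) :
    ringKrullDim (MvPolynomial n K ⧸ RingHom.ker (MvPolynomial.aeval (R := K) y)) =
      (Module.finrank L (LinearMap.range (evalDer K y)) : ℕ) := by
  set I := RingHom.ker (MvPolynomial.aeval (R := K) y)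
  set R := MvPolynomial n K ⧸ I
  have : Nontrivial R := Ideal.Quotient.nontrivial_iff.2 (RingHom.ker_ne_top _)
  let ι : R →ₐ[K] L := Ideal.kerLiftAlg (MvPolynomial.aeval (R := K) y)
  have hι : Function.Injective ι := Ideal.kerLiftAlg_injective _
  obtain ⟨s, g, hg, hgi⟩ := exists_integral_inj_algHom_of_fg K R
  let : Algebra (MvPolynomial (Fin s) K) R := g.toRingHom.toAlgebra
  have : Algebra.IsIntegral (MvPolynomial (Fin s) K) R := ⟨hgi⟩
  rw [ringKrullDim_eq_of_isIntegral (R := MvPolynomial (Fin s) K) hg,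
    MvPolynomial.ringKrullDim_of_isNoetherianRing, ringKrullDim_eq_zero_of_field]
  let z : Fin s → L := fun i => ι (g (MvPolynomial.X i))
  have hcomp : MvPolynomial.aeval (R := K) z = ι.comp g := by
    ext i; simp [z]
  have hz : AlgebraicIndependent K z := by
    rw [AlgebraicIndependent, hcomp]
    exact hι.comp hg
  have hsurj : Function.Surjective (evalDer K z) := fun v => by
    obtain ⟨D, hD⟩ := exists_derivation_of_algebraicIndependent hz v
    exact ⟨D, funext hD⟩
  -- The Noether parameters `z` are polynomials in `y`, and each `y i` is integral over `K[z]`, so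
  -- the same derivations kill both families; the two ranks agree, and the one at `z` is full.
  have hker : LinearMap.ker (evalDer K y) = LinearMap.ker (evalDer K z) := by
    ext D
    simp only [LinearMap.mem_ker, funext_iff, Pi.zero_apply]
    change (∀ i, D (y i) = 0) ↔ ∀ i, D (z i) = 0
    constructor
    · intro h i
      obtain ⟨p, hp⟩ := Ideal.Quotient.mk_surjective (g (MvPolynomial.X i))
      have : z i = MvPolynomial.aeval y p := by
        simp only [z, ← hp]; rfl
      rw [this]
      exact derivation_aeval_eq_zero h p
    · intro h i
      let : Algebra (MvPolynomial (Fin s) K) L := (MvPolynomial.aeval (R := K) z).toAlgebra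
      refine derivation_eq_zero_of_isIntegral (P := MvPolynomial (Fin s) K) D
        (fun p => derivation_aeval_eq_zero h p) ?_
      have hy : y i = ι (Ideal.Quotient.mk I (MvPolynomial.X i)) := by
        change y i = MvPolynomial.aeval y (MvPolynomial.X i)
        simp
      obtain ⟨p, hp, hpx⟩ := hgi (Ideal.Quotient.mk I (MvPolynomial.X i))
      refine ⟨p, hp, ?_⟩
      have : algebraMap (MvPolynomial (Fin s) K) L = ι.toRingHom.comp g.toRingHom :=
        congrArg AlgHom.toRingHom hcomp
      rw [this, hy]
      have h2 := congrArg ι.toRingHom hpx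
      rw [Polynomial.hom_eval₂, map_zero] at h2
      exact h2
  have e1 := (evalDer K y).quotKerEquivRange
  have e2 := (evalDer K z).quotKerEquivRange
  have e3 := Submodule.quotEquivOfEq _ _ hker
  rw [((e1.symm.trans e3).trans e2).finrank_eq, LinearMap.range_eq_top.2 hsurj, finrank_top]
  simp

end Derivations

/-! ### Extension of scalars for subspaces of `Kⁿ` -/

section Extend

variable {K n : Type*} [Field K] (L : Type*) [Field L] [Algebra K L]

/-- The `L`-span in `Lⁿ` of a subspace of `Kⁿ`. -/
def extendScalars (W : Submodule K (n → K)) : Submodule L (n → L) :=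
  Submodule.span L ((fun w k => algebraMap K L (w k)) '' (W : Set (n → K)))

variable {L}

/-- A `K`-linear retraction `L → K`, applied coordinatewise, carries the `L`-span back into `W`. -/
theorem algebraMap_mem_extendScalars_iff {W : Submodule K (n → K)} {w : n → K} :
    (fun k => algebraMap K L (w k)) ∈ extendScalars L W ↔ w ∈ W := by
  refine ⟨fun h => ?_, fun h => Submodule.subset_span ⟨w, h, rfl⟩⟩
  obtain ⟨r, hr⟩ := (Algebra.linearMap K L).exists_leftInverse_of_injective
    (LinearMap.ker_eq_bot.2 (algebraMap K L).injective)
  have hr' : ∀ x, r (algebraMap K L x) = x := fun x => LinearMap.congr_fun hr x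
  -- The retraction is only `K`-linear; quantifying over `l` lets the induction absorb scalars from
  -- `L`.
  have key : ∀ v ∈ extendScalars L W, ∀ l : L, (fun k => r (l * v k)) ∈ W := by
    intro v hv
    induction hv using Submodule.span_induction with
    | mem v hv =>
      obtain ⟨w, hw, rfl⟩ := hv
      intro l
      have : (fun k => r (l * algebraMap K L (w k))) = r l • w := by
        ext k
        rw [mul_comm, ← Algebra.smul_def, map_smul, Pi.smul_apply, smul_eq_mul, smul_eq_mul,
          mul_comm]
      rw [this]
      exact W.smul_mem _ hw
    | zero =>
      intro l
      simp only [Pi.zero_apply, mul_zero, map_zero]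
      exact W.zero_mem
    | add x y _ _ hx hy =>
      intro l
      simpa only [Pi.add_apply, mul_add, map_add] using! W.add_mem (hx l) (hy l)
    | smul c x _ hx =>
      intro l
      simpa only [Pi.smul_apply, smul_eq_mul, mul_assoc] using hx (l * c)
  simpa [hr'] using key _ h 1

theorem finrank_extendScalars [Finite n] (W : Submodule K (n → K)) :
    Module.finrank L (extendScalars L W) = Module.finrank K W := by
  let b := Module.finBasis K W
  let v : Fin (Module.finrank K W) → n → L := fun j k => algebraMap K L ((b j : n → K) k)
  have hspan : extendScalars L W = Submodule.span L (Set.range v) := by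
    apply le_antisymm
    · refine Submodule.span_le.2 ?_
      rintro _ ⟨w, hw, rfl⟩
      have : (fun k => algebraMap K L (w k)) =
          ∑ j, algebraMap K L (b.repr ⟨w, hw⟩ j) • v j := by
        have h := congrArg (Subtype.val) (b.sum_repr ⟨w, hw⟩)
        ext k
        have h2 : w k = ∑ j, b.repr ⟨w, hw⟩ j * (b j : n → K) k := by
          simpa [Finset.sum_apply, -Module.Basis.sum_repr] using (congrFun h k).symm
        simp only [h2]
        simp [v, Finset.sum_apply, Algebra.smul_def]
      change (fun k => algebraMap K L (w k)) ∈ _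
      rw [this]
      exact sum_mem fun j _ => Submodule.smul_mem _ _ (Submodule.subset_span ⟨j, rfl⟩)
    · refine Submodule.span_le.2 ?_
      rintro _ ⟨j, rfl⟩
      exact Submodule.subset_span ⟨b j, (b j).2, rfl⟩
  have hli : LinearIndependent L v := by
    rw [Fintype.linearIndependent_iff]
    intro g hg j
    -- Taking coordinates in a `K`-basis of `L` turns an `L`-relation into a family of
    -- `K`-relations.
    let e := Module.Basis.ofVectorSpace K L
    apply e.repr.injective
    ext α
    have hb := Fintype.linearIndependent_iff.1
      (b.linearIndependent.map' W.subtype (Submodule.ker_subtype W)) (fun j => e.repr (g j) α) (by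
        ext k
        have := congrArg (fun x => e.repr x α) (congrFun hg k)
        simpa [v, Finset.sum_apply, mul_comm (g _), ← Algebra.smul_def,
          mul_comm (e.repr _ _)] using this) j
    simpa using hb
  rw [hspan, finrank_span_eq_card hli, Fintype.card_fin]

end Extend

/-! ### Matrix coefficients and invariant derivations -/

section Hopf

variable {K A : Type*} [Field K] [CommRing A] [HopfAlgebra K A]

/-- Leibniz rule for the convolution of an algebra homomorphism and a twisted derivation. -/
theorem convMul_leibniz {B : Type*} [CommRing B] [Algebra K B] (φ v : WithConv (A →ₐ[K] B))
    {ψ : WithConv (A →ₗ[K] B)} (h : ∀ a b, ψ (a * b) = v a * ψ b + ψ a * v b) (a b : A) :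
    (WithConv.toConv φ.ofConv.toLinearMap * ψ) (a * b) =
      (φ * v) a * (WithConv.toConv φ.ofConv.toLinearMap * ψ) b +
      (WithConv.toConv φ.ofConv.toLinearMap * ψ) a * (φ * v) b := by
  simp only [LinearMap.convMul_apply, AlgHom.convMul_apply, Bialgebra.comul_mul]
  generalize Coalgebra.comul (R := K) a = x
  generalize Coalgebra.comul (R := K) b = y
  induction x using TensorProduct.induction_on with
  | zero => simp
  | add x x' hx hy => simp only [add_mul, map_add, hx, hy]; ring
  | tmul x x' =>
    induction y using TensorProduct.induction_on with
    | zero => simp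
    | add z w hz hw => simp only [mul_add, map_add, hz, hw]; ring
    | tmul z w =>
      simp [h]
      ring

/-- A multiplicative matrix over the coordinate ring: the matrix of a representation of `G`. -/
structure IsMultiplicative {n : Type*} [Fintype n] [DecidableEq n] (ρ : Matrix n n A) : Prop where
  comul (i j : n) : Coalgebra.comul (R := K) (ρ i j) = ∑ k, ρ i k ⊗ₜ[K] ρ k j
  counit (i j : n) : Coalgebra.counit (R := K) (ρ i j) = if i = j then 1 else 0

variable {n : Type*} {ρ : Matrix n n A}

/-- The inverse of a point of `G` with values in a commutative algebra. -/
def convInverse {B : Type*} [CommRing B] [Algebra K B] (φ : WithConv (A →ₐ[K] B)) :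
    WithConv (A →ₐ[K] B) :=
  WithConv.toConv (φ.ofConv.comp (HopfAlgebra.antipodeAlgHom K A))

namespace IsMultiplicative

variable [Fintype n] [DecidableEq n] {B : Type*} [CommRing B] [Algebra K B]

theorem convMul_apply (hρ : IsMultiplicative (K := K) ρ) (φ ψ : WithConv (A →ₗ[K] B)) (i j : n) :
    (φ * ψ) (ρ i j) = ∑ k, φ (ρ i k) * ψ (ρ k j) := by
  rw [LinearMap.convMul_apply, hρ.comul]
  simp

theorem algHom_convMul_apply (hρ : IsMultiplicative (K := K) ρ) (φ ψ : WithConv (A →ₐ[K] B))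
    (i j : n) : (φ * ψ) (ρ i j) = ∑ k, φ (ρ i k) * ψ (ρ k j) := by
  rw [AlgHom.convMul_apply, hρ.comul]
  simp

theorem one_apply (hρ : IsMultiplicative (K := K) ρ) (i j : n) :
    (1 : WithConv (A →ₐ[K] B)) (ρ i j) = if i = j then 1 else 0 := by
  rw [AlgHom.convOne_apply, hρ.counit]
  split_ifs <;> simp

theorem _root_.AdjointRank.convInverse_mul_self (φ : WithConv (A →ₐ[K] B)) :
    convInverse φ * φ = 1 := by
  have h := AlgHom.comp_convMul_distrib φ.ofConv
    (WithConv.toConv (HopfAlgebra.antipodeAlgHom K A)) (WithConv.toConv (AlgHom.id K A))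
  rw [AlgHom.antipode_id_cancel] at h
  refine Eq.trans (congrArg WithConv.toConv h.symm) ?_
  ext a
  simp [AlgHom.convOne_def]

theorem sum_inv_mul (hρ : IsMultiplicative (K := K) ρ) (φ : WithConv (A →ₐ[K] B)) (i j : n) :
    ∑ k, convInverse φ (ρ i k) * φ (ρ k j) = if i = j then 1 else 0 := by
  rw [← hρ.algHom_convMul_apply, convInverse_mul_self, hρ.one_apply]

theorem sum_mul_inv (hρ : IsMultiplicative (K := K) ρ) (φ : WithConv (A →ₐ[K] B)) (i j : n) :
    ∑ k, φ (ρ i k) * convInverse φ (ρ k j) = if i = j then 1 else 0 := by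
  have h : (Matrix.of fun i j => convInverse φ (ρ i j)) * (Matrix.of fun i j => φ (ρ i j)) = 1 := by
    ext i j
    rw [Matrix.mul_apply, Matrix.one_apply]
    exact hρ.sum_inv_mul φ i j
  have h' := mul_eq_one_comm.1 h
  have h2 := congrFun (congrFun h' i) j
  rwa [Matrix.mul_apply, Matrix.one_apply] at h2

end IsMultiplicative

variable (K) in
/-- The space of the `X.e_o`, `X ∈ 𝔤`, for the representation with matrix `ρ`. -/
def lieVec (ρ : Matrix n n A) (o : n) : Submodule K (n → K) :=
  LinearMap.range (M := lieAlg K A)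
    { toFun := fun X k => X.1 (ρ k o)
      map_add' := fun _ _ => rfl
      map_smul' := fun _ _ => rfl : lieAlg K A →ₗ[K] (n → K) }

theorem mem_lieVec {o : n} {w : n → K} :
    w ∈ lieVec K ρ o ↔ ∃ X : lieAlg K A, ∀ k, X.1 (ρ k o) = w k := by
  simp only [lieVec, LinearMap.mem_range]
  exact exists_congr fun X => funext_iff

open scoped Classical in
/-- The values of a point derivation at the identity with values in an extension of `K`. -/
theorem pointDerivation_mem_extendScalars [Finite n] {L : Type*} [Field L] [Algebra K L] (o : n)
    (δ : A →ₗ[K] L) (hδ : ∀ a b, δ (a * b) =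
      algebraMap K L (Coalgebra.counit a) * δ b + δ a * algebraMap K L (Coalgebra.counit b)) :
    (fun k => δ (ρ k o)) ∈ extendScalars L (lieVec K ρ o) := by
  have := Fintype.ofFinite n
  let e := Module.Basis.ofVectorSpace K L
  -- Each coordinate of `δ` in a `K`-basis of `L` is an ordinary element of `𝔤`; only finitely many
  -- basis vectors occur in the values on one column.
  let X := fun α => (⟨WithConv.toConv (e.coord α ∘ₗ δ), fun a b => by
    change e.coord α (δ (a * b)) = Coalgebra.counit (R := K) a * e.coord α (δ b) +
      e.coord α (δ a) * Coalgebra.counit (R := K) b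
    rw [hδ, map_add, ← Algebra.smul_def, map_smul, mul_comm (δ a), ← Algebra.smul_def, map_smul,
      smul_eq_mul, smul_eq_mul, mul_comm (e.coord α (δ a))]⟩ : lieAlg K A)
  let S := Finset.univ.biUnion fun k => (e.repr (δ (ρ k o))).support
  have h : (fun k => δ (ρ k o)) =
      ∑ α ∈ S, e α • fun k => algebraMap K L ((X α).1 (ρ k o)) := by
    ext k
    rw [Finset.sum_apply]
    conv_lhs => rw [← e.linearCombination_repr (δ (ρ k o))]
    rw [Finsupp.linearCombination_apply, Finsupp.sum_of_support_subset _ (s := S)]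
    · refine Finset.sum_congr rfl fun α _ => ?_
      rw [Algebra.smul_def, mul_comm]
      rfl
    · exact Finset.subset_biUnion_of_mem (fun k => (e.repr (δ (ρ k o))).support)
        (Finset.mem_univ k)
    · simp
  rw [h]
  exact sum_mem fun α _ => Submodule.smul_mem _ _
    (Submodule.subset_span ⟨_, mem_lieVec.2 ⟨X α, fun _ => rfl⟩, rfl⟩)

variable [Fintype n] [DecidableEq n]

/-- The logarithmic derivative `u⁻¹ D(u)` of a point `u` of `G` with values in `L` belongs
to `𝔤 ⊗ L`. -/
theorem logDerivative_mem_extendScalars (hρ : IsMultiplicative (K := K) ρ)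
    {L : Type*} [Field L] [Algebra K L] (u : WithConv (A →ₐ[K] L)) (D : Derivation K L L) (o : n) :
    (fun k => ∑ j, convInverse u (ρ k j) * D (u (ρ j o))) ∈ extendScalars L (lieVec K ρ o) := by
  let ψ : WithConv (A →ₗ[K] L) := WithConv.toConv ((D : L →ₗ[K] L) ∘ₗ u.ofConv.toLinearMap)
  have hψ : ∀ a, ψ a = D (u a) := fun _ => rfl
  -- `D ∘ u` satisfies a Leibniz rule twisted by `u`; convolving with `u⁻¹` turns the twist into
  -- `u⁻¹ * u = 1`, leaving a point derivation at the identity.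
  have h := convMul_leibniz (convInverse u) u (ψ := ψ) (fun a b => by
    rw [hψ, hψ, hψ, map_mul u.ofConv, D.leibniz, smul_eq_mul, smul_eq_mul, mul_comm (D (u a))])
  rw [convInverse_mul_self] at h
  have h2 := pointDerivation_mem_extendScalars (K := K) (ρ := ρ) (L := L) o
    (WithConv.toConv (convInverse u).ofConv.toLinearMap * ψ).ofConv h
  convert h2 using 2 with k
  exact (hρ.convMul_apply (WithConv.toConv (convInverse u).ofConv.toLinearMap) ψ k o).symm

/-- The left invariant derivation of `K[G]` with value `X` at the identity. -/
def invariantDerivation (X : lieAlg K A) : Derivation K A A :=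
  let φ : WithConv (A →ₐ[K] A) := WithConv.toConv (AlgHom.id K A)
  let ψ : WithConv (A →ₗ[K] A) := WithConv.toConv (Algebra.linearMap K A ∘ₗ X.1.ofConv)
  Derivation.mk' (WithConv.toConv φ.ofConv.toLinearMap * ψ).ofConv fun a b => by
    have h := convMul_leibniz φ 1 (ψ := ψ) (fun a b => by
      change algebraMap K A (X.1 (a * b)) = algebraMap K A (Coalgebra.counit a) *
        algebraMap K A (X.1 b) + algebraMap K A (X.1 a) * algebraMap K A (Coalgebra.counit b)
      rw [X.2 a b, map_add, map_mul, map_mul]) a b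
    rw [mul_one] at h
    refine h.trans ?_
    rw [smul_eq_mul, smul_eq_mul, mul_comm _ (φ b)]
    rfl

theorem invariantDerivation_apply (hρ : IsMultiplicative (K := K) ρ) (X : lieAlg K A) (i j : n) :
    invariantDerivation X (ρ i j) = ∑ k, ρ i k * algebraMap K A (X.1 (ρ k j)) :=
  hρ.convMul_apply _ _ i j

end Hopf

/-! ### Tangent spaces of projective orbits at their generic points -/

section Tangent

variable {K A : Type*} [Field K] [CommRing A] [HopfAlgebra K A]
  {n : Type*} [Fintype n] [DecidableEq n] {ρ : Matrix n n A}

/-- The differential at the point `M e_o` of the affine chart `x ↦ (xᵢ / x_c)ᵢ`, composed with `M`. -/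
def chartDifferential {L : Type*} [Field L] (M : Matrix n n L) (o c : n) :
    (n → L) →ₗ[L] (n → L) where
  toFun w i := (M c o)⁻¹ ^ 2 * (M c o * M.mulVec w i - M i o * M.mulVec w c)
  map_add' v w := by
    ext i
    simp only [Matrix.mulVec_add, Pi.add_apply]
    ring
  map_smul' r w := by
    ext i
    simp only [Matrix.mulVec_smul, Pi.smul_apply, smul_eq_mul, RingHom.id_apply]
    ring

theorem chartDifferential_apply {L : Type*} [Field L] (M : Matrix n n L) (o c : n) (w : n → L)
    (i : n) : chartDifferential M o c w i =
      (M c o)⁻¹ ^ 2 * (M c o * M.mulVec w i - M i o * M.mulVec w c) := rfl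

/-- The differential of the chart kills exactly the radial direction `M e_o`, and `N` pulls this
line back to that of `e_o`. -/
theorem ker_chartDifferential {L : Type*} [Field L] {M N : Matrix n n L} (hM : N * M = 1)
    {o c : n} (hc : M c o ≠ 0) :
    LinearMap.ker (chartDifferential M o c) = Submodule.span L {Pi.single o 1} := by
  apply le_antisymm
  · intro w hw
    rw [Submodule.mem_span_singleton]
    refine ⟨M.mulVec w c / M c o, ?_⟩
    have h : M.mulVec ((M.mulVec w c / M c o) • Pi.single o 1) = M.mulVec w := by
      ext i
      rw [Matrix.mulVec_smul, Matrix.mulVec_single_one]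
      have := congrFun hw i
      rw [chartDifferential_apply, Pi.zero_apply, mul_eq_zero, sub_eq_zero] at this
      have h2 := this.resolve_left (pow_ne_zero _ (inv_ne_zero hc))
      rw [Pi.smul_apply, smul_eq_mul, Matrix.col_apply]
      field_simp
      linear_combination -h2
    have h2 := congrArg N.mulVec h
    rwa [Matrix.mulVec_mulVec, Matrix.mulVec_mulVec, hM, Matrix.one_mulVec, Matrix.one_mulVec] at h2
  · rw [Submodule.span_singleton_le_iff_mem, LinearMap.mem_ker]
    ext i
    rw [chartDifferential_apply, Matrix.mulVec_single_one, Pi.zero_apply]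
    simp only [Matrix.col_apply]
    ring

variable {L : Type*} [Field L] [Algebra K L] [Algebra A L] [IsScalarTower K A L]
  [Algebra.FormallySmooth A L]

/-- The tangent space of the projective orbit at its generic point, in the chart `x_c ≠ 0`. -/
theorem range_evalDer_chart (hρ : IsMultiplicative (K := K) ρ) {o c : n} :
    LinearMap.range (evalDer K fun i => algebraMap A L (ρ i o) / algebraMap A L (ρ c o)) =
      (extendScalars L (lieVec K ρ o)).map
        (chartDifferential (ρ.map (algebraMap A L)) o c) := by
  let u : WithConv (A →ₐ[K] L) := WithConv.toConv (IsScalarTower.toAlgHom K A L)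
  have hu : ∀ a, u a = algebraMap A L a := fun _ => rfl
  -- This is the quotient rule for `x_i / x_c`.
  have key : ∀ (D : Derivation K L L) (w : n → L),
      (∀ i, D (algebraMap A L (ρ i o)) = (ρ.map (algebraMap A L)).mulVec w i) →
      chartDifferential (ρ.map (algebraMap A L)) o c w =
        evalDer K (fun i => algebraMap A L (ρ i o) / algebraMap A L (ρ c o)) D := by
    intro D w h
    ext i
    rw [chartDifferential_apply, ← h, ← h]
    change _ = D (_ / _)
    rw [D.leibniz_div]
    simp
  apply le_antisymm
  · rintro _ ⟨D, rfl⟩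
    -- The witness is column `o` of `u⁻¹ D(u)`; multiplying by the matrix of `u` recovers `D(u)`.
    refine ⟨_, logDerivative_mem_extendScalars hρ u D o, key D _ fun i => ?_⟩
    have h : ∀ i j, ∑ k, algebraMap A L (ρ i k) * convInverse u (ρ k j) = if i = j then 1 else 0 :=
      fun i j => hρ.sum_mul_inv u i j
    simp only [Matrix.mulVec, dotProduct, Matrix.map_apply, Finset.mul_sum, ← mul_assoc]
    rw [Finset.sum_comm]
    simp only [← Finset.sum_mul, h, hu]
    simp
  · rw [Submodule.map_le_iff_le_comap, extendScalars, Submodule.span_le]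
    rintro _ ⟨w, hw, rfl⟩
    obtain ⟨X, hX⟩ := mem_lieVec.1 hw
    obtain ⟨D, hD⟩ := exists_derivation_extension (K := K) (P := A) (L := L)
      ((Algebra.linearMap A L).compDer (invariantDerivation X))
    refine ⟨D, (key D _ fun i => ?_).symm⟩
    rw [hD]
    change algebraMap A L (invariantDerivation X (ρ i o)) = _
    rw [invariantDerivation_apply hρ, map_sum]
    simp only [Matrix.mulVec, dotProduct, Matrix.map_apply, map_mul, hX]
    simp only [← IsScalarTower.algebraMap_apply K A L]

/-- Rank-nullity on `U`: the kernel meets `U` in the whole line or in zero. -/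
theorem finrank_map_of_ker_eq_span_singleton {V W : Type*} [AddCommGroup V] [Module L V]
    [AddCommGroup W] [Module L W] [FiniteDimensional L V] (Φ : V →ₗ[L] W) {e : V} (he : e ≠ 0)
    (hΦ : LinearMap.ker Φ = Submodule.span L {e}) (U : Submodule L V) :
    (e ∈ U → Module.finrank L (U.map Φ) + 1 = Module.finrank L U) ∧
    (e ∉ U → Module.finrank L (U.map Φ) = Module.finrank L U) := by
  have h := LinearMap.finrank_range_add_finrank_ker (Φ.domRestrict U)
  rw [LinearMap.range_domRestrict] at h
  have hker : ∀ x : U, x ∈ LinearMap.ker (Φ.domRestrict U) ↔ ∃ a : L, a • e = x := by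
    intro x
    rw [LinearMap.mem_ker, LinearMap.domRestrict_apply, ← LinearMap.mem_ker, hΦ,
      Submodule.mem_span_singleton]
  constructor
  · intro heU
    have : LinearMap.ker (Φ.domRestrict U) = Submodule.span L {(⟨e, heU⟩ : U)} := by
      ext x
      rw [hker, Submodule.mem_span_singleton]
      simp [Subtype.ext_iff]
    rw [this, finrank_span_singleton (by simpa [Subtype.ext_iff] using he)] at h
    exact h
  · intro heU
    have : LinearMap.ker (Φ.domRestrict U) = ⊥ := by
      rw [eq_bot_iff]
      intro x hx
      obtain ⟨a, ha⟩ := (hker x).1 hx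
      by_cases h0 : a = 0
      · rw [Submodule.mem_bot, Subtype.ext_iff, ← ha, h0, zero_smul]; rfl
      · refine absurd ?_ heU
        have := U.smul_mem a⁻¹ x.2
        rwa [← ha, smul_smul, inv_mul_cancel₀ h0, one_smul] at this
    rw [this, finrank_bot] at h
    exact h

theorem finrank_range_evalDer_chart (hρ : IsMultiplicative (K := K) ρ) {o c : n}
    (hc : algebraMap A L (ρ c o) ≠ 0) :
    (Pi.single o 1 ∈ lieVec K ρ o →
      Module.finrank L (LinearMap.range
        (evalDer K fun i => algebraMap A L (ρ i o) / algebraMap A L (ρ c o))) + 1 =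
        Module.finrank K (lieVec K ρ o)) ∧
    (Pi.single o 1 ∉ lieVec K ρ o →
      Module.finrank L (LinearMap.range
        (evalDer K fun i => algebraMap A L (ρ i o) / algebraMap A L (ρ c o))) =
        Module.finrank K (lieVec K ρ o)) := by
  let u : WithConv (A →ₐ[K] L) := WithConv.toConv (IsScalarTower.toAlgHom K A L)
  have hM : (Matrix.of fun i j => convInverse u (ρ i j)) * ρ.map (algebraMap A L) = 1 := by
    ext i j
    rw [Matrix.mul_apply, Matrix.one_apply]
    exact hρ.sum_inv_mul u i j
  have h := finrank_map_of_ker_eq_span_singleton (chartDifferential (ρ.map (algebraMap A L)) o c)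
    (by simp) (ker_chartDifferential hM hc) (extendScalars L (lieVec K ρ o))
  have he : (Pi.single o 1 : n → L) = fun k => algebraMap K L ((Pi.single o 1 : n → K) k) := by
    ext k
    rcases eq_or_ne k o with rfl | hk <;> simp [*]
  rwa [he, algebraMap_mem_extendScalars_iff, finrank_extendScalars,
    ← range_evalDer_chart hρ] at h

end Tangent

/-! ### Conical orbits -/

section Conical

variable {K A : Type*} [Field K] [CommRing A] [HopfAlgebra K A]
  {n : Type*} [Fintype n] [DecidableEq n] {ρ : Matrix n n A}

/-- The ideal of the stabilizer of the line through `e_o`. -/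
def lineIdeal (ρ : Matrix n n A) (o : n) : Ideal A := Ideal.span {a | ∃ k, k ≠ o ∧ a = ρ k o}

/-- The elements `P(ρ_oo)` with `P ≠ 0` form a multiplicative set missing `lineIdeal`, so some prime
above that ideal misses it too. -/
theorem exists_prime_of_transcendental {o : n}
    (h : ∀ P : Polynomial K, Polynomial.aeval (ρ o o) P ∈ lineIdeal ρ o → P = 0) :
    ∃ q : Ideal A, q.IsPrime ∧ (∀ k, k ≠ o → ρ k o ∈ q) ∧
      ∀ P : Polynomial K, Polynomial.aeval (ρ o o) P ∈ q → P = 0 := by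
  let S : Submonoid A := (nonZeroDivisors (Polynomial K)).map (Polynomial.aeval (ρ o o))
  have hS : Disjoint (lineIdeal ρ o : Set A) (S : Set A) := by
    rw [Set.disjoint_left]
    rintro _ ha ⟨P, hP, rfl⟩
    exact nonZeroDivisors.ne_zero hP (h P ha)
  obtain ⟨q, hq, hle, hdis⟩ := Ideal.exists_le_prime_disjoint _ S hS
  refine ⟨q, hq, fun k hk => hle (Ideal.subset_span ⟨k, hk, rfl⟩), fun P hP => ?_⟩
  by_contra h0
  exact Set.disjoint_left.1 hdis hP ⟨P, mem_nonZeroDivisors_of_ne_zero h0, rfl⟩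

/-- If the orbit of `e_o` is conical, then `e_o` is tangent to it. -/
theorem single_mem_lieVec [CharZero K] [Algebra.FiniteType K A]
    (hρ : IsMultiplicative (K := K) ρ) {o : n}
    (h : ∀ c : K, c ≠ 0 → ∃ g : Points K A, ∀ k, g (ρ k o) = (Pi.single o c : n → K) k) :
    Pi.single o 1 ∈ lieVec K ρ o := by
  obtain ⟨q, hq, hqo, hqP⟩ := exists_prime_of_transcendental (K := K) (ρ := ρ) (o := o) (by
    intro P hP
    refine Polynomial.eq_zero_of_infinite_isRoot P
      (Set.Infinite.mono (s := {0}ᶜ) ?_ (Set.finite_singleton (0 : K)).infinite_compl)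
    intro c hc
    obtain ⟨g, hg⟩ := h c hc
    have hle : lineIdeal ρ o ≤ RingHom.ker g.ofConv := by
      refine Ideal.span_le.2 ?_
      rintro _ ⟨k, hk, rfl⟩
      exact (hg k).trans (by simp [hk])
    have h0 : g.ofConv (Polynomial.aeval (ρ o o) P) = 0 := hle hP
    have ho : g.ofConv (ρ o o) = c := (hg o).trans (by simp)
    rwa [← Polynomial.aeval_algHom_apply, ho, Polynomial.coe_aeval_eq_eval] at h0)
  let L := FractionRing (A ⧸ q)
  have : Algebra.EssFiniteType K L := inferInstance
  let u : WithConv (A →ₐ[K] L) := WithConv.toConv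
    ((IsScalarTower.toAlgHom K (A ⧸ q) L).comp (Ideal.Quotient.mkₐ K q))
  have hu : ∀ a, u a = 0 ↔ a ∈ q := by
    intro a
    change algebraMap (A ⧸ q) L (Ideal.Quotient.mk q a) = 0 ↔ _
    rw [map_eq_zero_iff _ (IsFractionRing.injective (A ⧸ q) L), Ideal.Quotient.eq_zero_iff_mem]
  have hz : AlgebraicIndependent K (fun _ : Unit => u (ρ o o)) := by
    rw [algebraicIndependent_unique_type_iff, transcendental_iff]
    intro P hP
    refine hqP P ((hu _).1 ?_)
    change u.ofConv _ = 0
    rw [← Polynomial.aeval_algHom_apply]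
    exact hP
  -- With `D t = t` for `t = u(ρ_oo)`, and the rest of column `o` zero under `u`, one gets `D(u) e_o
  -- = u e_o`, hence `u⁻¹ D(u) e_o = e_o`.
  obtain ⟨D, hD⟩ := exists_derivation_of_algebraicIndependent hz (fun _ => u (ρ o o))
  rw [← algebraMap_mem_extendScalars_iff (L := L)]
  convert logDerivative_mem_extendScalars hρ u D o using 2 with k
  have hDj : ∀ j, D (u (ρ j o)) = u (ρ j o) := by
    intro j
    by_cases hj : j = o
    · rw [hj, hD ()]
    · rw [(hu _).2 (hqo j hj), map_zero]
  simp only [hDj, hρ.sum_inv_mul, Pi.single_apply]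
  split_ifs <;> simp

/-- If `X.e_o = e_o`, the invariant derivation of `X` fixes column `o`, so it preserves `lineIdeal`.
As `ρ_oo` is a unit modulo this ideal, a relation `P(ρ_oo) = 0` there implies `P'(ρ_oo) = 0`.
Descent on the degree leaves a constant, which must be zero because the counit kills the ideal. -/
theorem transcendental_of_single_mem_lieVec [CharZero K] (hρ : IsMultiplicative (K := K) ρ) {o : n}
    (h : Pi.single o 1 ∈ lieVec K ρ o) (P : Polynomial K)
    (hP : Polynomial.aeval (ρ o o) P ∈ lineIdeal ρ o) : P = 0 := by
  obtain ⟨X, hX⟩ := mem_lieVec.1 h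
  have hD : ∀ i, invariantDerivation X (ρ i o) = ρ i o := by
    intro i
    rw [invariantDerivation_apply hρ]
    simp [hX, Pi.single_apply]
  have hDI : ∀ a ∈ lineIdeal ρ o, invariantDerivation X a ∈ lineIdeal ρ o := by
    intro a ha
    induction ha using Submodule.span_induction with
    | mem a ha => obtain ⟨k, hk, rfl⟩ := ha; rw [hD]; exact Ideal.subset_span ⟨k, hk, rfl⟩
    | zero => rw [map_zero]; exact zero_mem _
    | add a b _ _ ha hb => rw [map_add]; exact add_mem ha hb
    | smul c a hmem ha =>
      rw [smul_eq_mul, Derivation.leibniz, smul_eq_mul, smul_eq_mul]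
      exact add_mem (Ideal.mul_mem_left _ _ ha) (Ideal.mul_mem_right _ _ hmem)
  have hunit : ∃ s, s * ρ o o - 1 ∈ lineIdeal ρ o := by
    have h1 := hρ.sum_inv_mul (WithConv.toConv (AlgHom.id K A)) o o
    rw [if_pos rfl, ← Finset.add_sum_erase _ _ (Finset.mem_univ o)] at h1
    refine ⟨convInverse (WithConv.toConv (AlgHom.id K A)) (ρ o o), ?_⟩
    rw [← h1, ← sub_sub, sub_eq_add_neg]
    change _ * ρ o o - _ * ρ o o + _ ∈ _
    rw [sub_self, zero_add]
    exact neg_mem (sum_mem fun k hk => Ideal.mul_mem_left _ _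
      (Ideal.subset_span ⟨k, Finset.ne_of_mem_erase hk, rfl⟩))
  have hε : lineIdeal ρ o ≤ RingHom.ker (Bialgebra.counitAlgHom K A) := by
    refine Ideal.span_le.2 ?_
    rintro _ ⟨k, hk, rfl⟩
    exact (hρ.counit k o).trans (if_neg hk)
  obtain ⟨s, hs⟩ := hunit
  induction hN : P.natDegree using Nat.strong_induction_on generalizing P with
  | _ N ih =>
    have hder : Polynomial.aeval (ρ o o) (Polynomial.derivative P) ∈ lineIdeal ρ o := by
      have h1 := hDI _ hP
      rw [Derivation.map_aeval, hD, smul_eq_mul] at h1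
      have h2 : Polynomial.aeval (ρ o o) (Polynomial.derivative P) =
          s * (Polynomial.aeval (ρ o o) (Polynomial.derivative P) * ρ o o) -
          Polynomial.aeval (ρ o o) (Polynomial.derivative P) * (s * ρ o o - 1) := by ring
      rw [h2]
      exact sub_mem (Ideal.mul_mem_left _ _ h1) (Ideal.mul_mem_left _ _ hs)
    have h0 : P.natDegree = 0 := by
      by_contra hne
      have := ih _ (hN ▸ Polynomial.natDegree_derivative_lt hne) _ hder rfl
      exact hne (Polynomial.derivative_eq_zero.1 this)
    rw [Polynomial.eq_C_of_natDegree_eq_zero h0] at hP ⊢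
    have h1 := hε hP
    rw [RingHom.mem_ker, Polynomial.aeval_C, AlgHom.commutes] at h1
    rw [show P.coeff 0 = 0 from h1, Polynomial.C_0]

/-- A regular function on an affine variety that is transcendental over `K` takes almost all
values. -/
theorem exists_polynomial_forall_exists_algHom [IsAlgClosed K] {B : Type*} [CommRing B] [IsDomain B]
    [Algebra K B] [Algebra.FiniteType K B] {t : B} (ht : Transcendental K t) :
    ∃ h : Polynomial K, h ≠ 0 ∧ ∀ c, h.eval c ≠ 0 → ∃ φ : B →ₐ[K] K, φ t = c := by
  let : Algebra (Polynomial K) B := (Polynomial.aeval (R := K) t).toAlgebra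
  have hmap : ∀ P, algebraMap (Polynomial K) B P = Polynomial.aeval t P := fun _ => rfl
  have : IsScalarTower K (Polynomial K) B := .of_algebraMap_eq fun x => by simp [hmap]
  have hinj : Function.Injective (algebraMap (Polynomial K) B) :=
    (injective_iff_map_eq_zero _).2 (transcendental_iff.1 ht)
  have : FaithfulSMul (Polynomial K) B := (faithfulSMul_iff_algebraMap_injective _ _).2 hinj
  -- Torsion-free over the principal ideal domain `K[X]` means flat, so the map on spectra is open.
  -- Its image contains the generic point, hence a basic open set `D(h)`.
  have : Module.IsTorsionFree (Polynomial K) B := inferInstance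
  have : Module.Flat (Polynomial K) B := inferInstance
  have : Algebra.FiniteType (Polynomial K) B := Algebra.FiniteType.of_restrictScalars_finiteType K _ _
  have : Algebra.FinitePresentation (Polynomial K) B :=
    Algebra.FinitePresentation.of_finiteType.1 inferInstance
  have hopen := (PrimeSpectrum.isOpenMap_comap_of_hasGoingDown_of_finitePresentation
    (R := Polynomial K) (S := B)).isOpen_range
  have hbot : (⊥ : PrimeSpectrum (Polynomial K)) ∈
      Set.range (PrimeSpectrum.comap (algebraMap (Polynomial K) B)) := by
    refine ⟨⊥, PrimeSpectrum.ext ?_⟩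
    change Ideal.comap _ ⊥ = ⊥
    rw [← RingHom.ker_eq_comap_bot]
    exact (RingHom.injective_iff_ker_eq_bot _).1 hinj
  obtain ⟨_, ⟨h, rfl⟩, hh, hle⟩ :=
    PrimeSpectrum.isTopologicalBasis_basic_opens.exists_subset_of_mem_open hbot hopen
  refine ⟨h, fun h0 => ?_, fun c hc => ?_⟩
  · simp [h0] at hh
  · have hprime : (Ideal.span {Polynomial.X - Polynomial.C c}).IsPrime :=
      (Ideal.span_singleton_prime (Polynomial.X_sub_C_ne_zero c)).2 (Polynomial.prime_X_sub_C c)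
    obtain ⟨P, hP⟩ := hle (show (⟨_, hprime⟩ : PrimeSpectrum (Polynomial K)) ∈ _ from by
      change h ∉ Ideal.span _
      rw [Ideal.mem_span_singleton, Polynomial.dvd_iff_isRoot]
      exact hc)
    obtain ⟨φ, hφ⟩ := exists_algHom_le_ker (K := K) P.2.ne_top
    refine ⟨φ, ?_⟩
    have h1 : Polynomial.X - Polynomial.C c ∈ (PrimeSpectrum.comap
        (algebraMap (Polynomial K) B) P).asIdeal := by
      rw [hP]
      exact Ideal.mem_span_singleton_self _
    have h2 := hφ _ h1
    rw [hmap] at h2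
    simpa [sub_eq_zero] using h2

/-- If `e_o` is tangent to its orbit, then the orbit is conical. -/
theorem exists_point_of_single_mem_lieVec [CharZero K] [IsAlgClosed K] [Algebra.FiniteType K A]
    (hρ : IsMultiplicative (K := K) ρ) {o : n} (h : Pi.single o 1 ∈ lieVec K ρ o)
    (c : K) (hc : c ≠ 0) : ∃ g : Points K A, ∀ k, g (ρ k o) = (Pi.single o c : n → K) k := by
  classical
  obtain ⟨q, hq, hqo, hqP⟩ :=
    exists_prime_of_transcendental (transcendental_of_single_mem_lieVec hρ h)
  have ht : Transcendental K (Ideal.Quotient.mkₐ K q (ρ o o)) := by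
    rw [transcendental_iff]
    intro P hP
    rw [Polynomial.aeval_algHom_apply] at hP
    exact hqP P (Ideal.Quotient.eq_zero_iff_mem.1 hP)
  obtain ⟨f, hf, hfc⟩ := exists_polynomial_forall_exists_algHom ht
  have hpt : ∀ c, f.eval c ≠ 0 → ∃ g : Points K A, ∀ k, g (ρ k o) = (Pi.single o c : n → K) k := by
    intro c hc
    obtain ⟨φ, hφ⟩ := hfc c hc
    refine ⟨WithConv.toConv (φ.comp (Ideal.Quotient.mkₐ K q)), fun k => ?_⟩
    change φ (Ideal.Quotient.mk q (ρ k o)) = _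
    by_cases hk : k = o
    · rw [hk, Pi.single_eq_same]; exact hφ
    · rw [Ideal.Quotient.eq_zero_iff_mem.2 (hqo k hk), map_zero, Pi.single_eq_of_ne hk]
  -- Write `c = a * (c / a)` with both factors attained: excluding the roots `x` of `f` and the
  -- quotients `c / x` makes `f` nonzero at `a` and at `c / a`.
  obtain ⟨a, ha⟩ := Infinite.exists_notMem_finset
    (insert 0 (f.roots.toFinset ∪ f.roots.toFinset.image fun x => c / x))
  simp only [Finset.mem_insert, Finset.mem_union, Finset.mem_image, Multiset.mem_toFinset,
    Polynomial.mem_roots hf, Polynomial.IsRoot.def, not_or, not_exists, not_and] at ha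
  obtain ⟨ha0, ha1, ha2⟩ := ha
  obtain ⟨g₁, h₁⟩ := hpt a ha1
  obtain ⟨g₂, h₂⟩ := hpt (c / a) fun h0 => ha2 _ h0 (by field_simp)
  refine ⟨g₁ * g₂, fun k => ?_⟩
  rw [hρ.algHom_convMul_apply, Finset.sum_eq_single o]
  · rw [h₁, h₂, Pi.single_eq_same]
    by_cases hk : k = o
    · rw [hk, Pi.single_eq_same, Pi.single_eq_same]; field_simp
    · rw [Pi.single_eq_of_ne hk, Pi.single_eq_of_ne hk, zero_mul]
  · intro j _ hj
    rw [h₂, Pi.single_eq_of_ne hj, mul_zero]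
  · simp

end Conical

/-! ### Krull dimension of closed subspaces -/

/-- This replaces irreducible closed subsets of the subspace by those of the ambient space contained
in `Y`, where homogeneous equations are available. -/
theorem topologicalKrullDim_eq_of_isClosed {X : Type*} [TopologicalSpace X] {Y : Set X}
    (hY : IsClosed Y) : topologicalKrullDim Y =
      Order.krullDim {Z : TopologicalSpace.IrreducibleCloseds X // (Z : Set X) ⊆ Y} := by
  have hemb := hY.isClosedEmbedding_subtypeVal
  apply le_antisymm
  · refine Order.krullDim_le_of_strictMono
      (fun Z => ⟨TopologicalSpace.IrreducibleCloseds.map Subtype.val continuous_subtype_val Z, ?_⟩)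
      fun Z Z' h => TopologicalSpace.IrreducibleCloseds.map_strictMono_of_isInducing
        Topology.IsInducing.subtypeVal h
    rw [TopologicalSpace.IrreducibleCloseds.coe_map]
    exact hY.closure_subset_iff.2 (by rintro _ ⟨y, -, rfl⟩; exact y.2)
  · refine Order.krullDim_le_of_strictMono
      (fun Z => (⟨Subtype.val ⁻¹' (Z.1 : Set X), ⟨?_, ?_⟩,
        Z.1.isClosed.preimage continuous_subtype_val⟩ : TopologicalSpace.IrreducibleCloseds Y)) ?_
    · obtain ⟨x, hx⟩ := Z.1.isIrreducible.nonempty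
      exact ⟨⟨x, Z.2 hx⟩, hx⟩
    · rw [isPreirreducible_iff_isClosed_union_isClosed]
      intro z₁ z₂ h₁ h₂ h
      have h' : (Z.1 : Set X) ⊆ Subtype.val '' z₁ ∪ Subtype.val '' z₂ := by
        intro x hx
        rw [← Set.image_union]
        exact ⟨⟨x, Z.2 hx⟩, h hx, rfl⟩
      refine (isPreirreducible_iff_isClosed_union_isClosed.1 Z.1.isIrreducible.isPreirreducible
        _ _ (hemb.isClosedMap _ h₁) (hemb.isClosedMap _ h₂) h').imp ?_ ?_ <;>
      · intro hle y hy
        obtain ⟨y', hy', he⟩ := hle hy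
        rwa [← Subtype.ext he]
    · intro Z Z' h
      obtain ⟨hle, x, hx, hx'⟩ := Set.ssubset_iff_exists.1 (show (Z.1 : Set X) ⊂ Z'.1 from h)
      exact Set.ssubset_iff_exists.2 ⟨fun y hy => hle hy, ⟨x, Z'.2 hx⟩, hx, hx'⟩

/-! ### Homogenization -/

section Homogenize

variable {K n : Type*} [Field K]

/-- The homogenization of a polynomial with respect to one of its variables. -/
def homogenize (c : n) (p : MvPolynomial n K) : MvPolynomial n K :=
  ∑ i ∈ Finset.range (p.totalDegree + 1),
    MvPolynomial.homogeneousComponent i p * MvPolynomial.X c ^ (p.totalDegree - i)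

theorem isHomogeneous_homogenize (c : n) (p : MvPolynomial n K) :
    (homogenize c p).IsHomogeneous p.totalDegree := by
  refine MvPolynomial.IsHomogeneous.sum _ _ _ fun i hi => ?_
  have h := (MvPolynomial.homogeneousComponent_isHomogeneous i p).mul
    (MvPolynomial.isHomogeneous_X_pow (R := K) c (p.totalDegree - i))
  rwa [Nat.add_sub_cancel' (Nat.lt_succ_iff.1 (Finset.mem_range.1 hi))] at h

theorem isHomogeneous_X_mul_homogenize (c : n) (p : MvPolynomial n K) :
    (MvPolynomial.X c * homogenize c p).IsHomogeneous (1 + p.totalDegree) :=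
  (MvPolynomial.isHomogeneous_X K c).mul (isHomogeneous_homogenize c p)

theorem aeval_homogenize_of_eq_one {B : Type*} [CommRing B] [Algebra K B] {c : n} {y : n → B}
    (hy : y c = 1) (p : MvPolynomial n K) :
    MvPolynomial.aeval y (homogenize c p) = MvPolynomial.aeval y p := by
  conv_rhs => rw [← MvPolynomial.sum_homogeneousComponent p]
  simp [homogenize, map_sum, hy]

theorem aeval_smul_of_isHomogeneous {B : Type*} [CommRing B] [Algebra K B] {N : ℕ}
    {F : MvPolynomial n K} (hF : F.IsHomogeneous N) (a : B) (y : n → B) :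
    MvPolynomial.aeval (fun i => a * y i) F = a ^ N * MvPolynomial.aeval y F := by
  rw [F.as_sum, map_sum, map_sum, Finset.mul_sum]
  refine Finset.sum_congr rfl fun d hd => ?_
  rw [MvPolynomial.aeval_monomial, MvPolynomial.aeval_monomial]
  have hdeg : d.degree = N := by
    rw [Finsupp.degree_eq_weight_one]; exact hF (MvPolynomial.mem_support_iff.1 hd)
  simp only [Finsupp.prod, mul_pow, Finset.prod_mul_distrib, Finset.prod_pow_eq_pow_sum]
  rw [← hdeg, Finsupp.degree_apply]
  ring

theorem aeval_div_eq_zero_iff {L : Type*} [Field L] [Algebra K L] {N : ℕ}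
    {F : MvPolynomial n K} (hF : F.IsHomogeneous N) {c : n} {y : n → L} (hc : y c ≠ 0) :
    MvPolynomial.aeval (fun i => y i / y c) F = 0 ↔ MvPolynomial.aeval y F = 0 := by
  have h := aeval_smul_of_isHomogeneous hF (y c) (fun i => y i / y c)
  simp only [mul_div_cancel₀ _ hc] at h
  rw [h, mul_eq_zero, or_iff_right (pow_ne_zero _ hc)]

theorem aeval_homogenize_eq_zero_iff {L : Type*} [Field L] [Algebra K L] {c : n} {y : n → L}
    (hc : y c ≠ 0) (p : MvPolynomial n K) :
    MvPolynomial.aeval y (homogenize c p) = 0 ↔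
      MvPolynomial.aeval (fun i => y i / y c) p = 0 := by
  rw [← aeval_div_eq_zero_iff (isHomogeneous_homogenize c p) hc,
    aeval_homogenize_of_eq_one (y := fun i => y i / y c) (div_self hc)]

theorem map_aeval_homogenize_eq_zero_iff {A L : Type*} [CommRing A] [Algebra K A] [Field L]
    [Algebra K L] (u : A →ₐ[K] L) {c : n} {f : n → A} (hc : u (f c) ≠ 0) (p : MvPolynomial n K) :
    u (MvPolynomial.aeval f (homogenize c p)) = 0 ↔
      MvPolynomial.aeval (fun i => u (f i) / u (f c)) p = 0 := by
  rw [← aeval_homogenize_eq_zero_iff (y := fun i => u (f i)) hc, MvPolynomial.comp_aeval_apply]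

end Homogenize

/-! ### The Zariski topology of projective space in coordinates -/

section Proj

variable {K V n : Type*} [Field K] [AddCommGroup V] [Module K V] [Fintype n]
  (b : Module.Basis n K V)

attribute [local instance] projZariski

/-- Homogeneous coordinates of a point. -/
def coords (x : ℙ K V) : n → K := b.equivFun x.rep

/-- The projective hypersurface with a given equation. -/
def hypersurface (F : MvPolynomial n K) : Set (ℙ K V) :=
  {x | MvPolynomial.aeval (coords b x) F = 0}

theorem aeval_coords_mk {N : ℕ} {F : MvPolynomial n K} (hF : F.IsHomogeneous N) (w : V)
    (hw : w ≠ 0) : MvPolynomial.aeval (coords b (Projectivization.mk K w hw)) F = 0 ↔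
      MvPolynomial.aeval (b.equivFun w) F = 0 := by
  obtain ⟨a, ha⟩ := Projectivization.exists_smul_eq_mk_rep K w hw
  have h : coords b (Projectivization.mk K w hw) = fun i => (a : K) * b.equivFun w i := by
    ext i
    rw [coords, ← ha, Units.smul_def, map_smul, Pi.smul_apply, smul_eq_mul]
  rw [h, aeval_smul_of_isHomogeneous hF, mul_eq_zero, or_iff_right (pow_ne_zero _ a.ne_zero)]

theorem exists_coords_ne_zero (x : ℙ K V) : ∃ c, coords b x c ≠ 0 := by
  by_contra! h
  exact x.rep_nonzero (b.equivFun.map_eq_zero_iff.1 (funext h))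

/-- Linear forms in coordinates. -/
def toCoords : MvPolynomial (Module.Dual K V) K →ₐ[K] MvPolynomial n K :=
  MvPolynomial.aeval fun ξ => ∑ i, MvPolynomial.C (ξ (b i)) * MvPolynomial.X i

theorem aeval_toCoords (w : V) (p : MvPolynomial (Module.Dual K V) K) :
    MvPolynomial.aeval (b.equivFun w) (toCoords b p) =
      MvPolynomial.eval (fun ξ : Module.Dual K V => ξ w) p := by
  rw [← MvPolynomial.coe_aeval_eq_eval]
  change ((MvPolynomial.aeval (b.equivFun w)).comp (toCoords b)) p = MvPolynomial.aeval _ p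
  congr 1
  ext ξ
  have h : ξ w = ∑ i, b.equivFun w i * ξ (b i) := by
    conv_lhs => rw [← b.sum_equivFun w]
    simp [-Module.Basis.equivFun_apply]
  simp [toCoords, h, mul_comm]

theorem isHomogeneous_toCoords {N : ℕ} {p : MvPolynomial (Module.Dual K V) K}
    (hp : p.IsHomogeneous N) : (toCoords b p).IsHomogeneous N := by
  have := hp.aeval (n := 1) (fun ξ : Module.Dual K V => ∑ i : n,
    MvPolynomial.C (ξ (b i)) * MvPolynomial.X i) fun ξ =>
      MvPolynomial.IsHomogeneous.sum _ _ _ fun i _ => MvPolynomial.isHomogeneous_C_mul_X _ _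
  rwa [one_mul] at this

theorem eval_rename_coord (w : V) (F : MvPolynomial n K) :
    MvPolynomial.eval (fun ξ : Module.Dual K V => ξ w) (MvPolynomial.rename b.coord F) =
      MvPolynomial.aeval (b.equivFun w) F := by
  rw [MvPolynomial.eval_rename, ← MvPolynomial.coe_aeval_eq_eval]
  rfl

theorem isClosed_hypersurface {N : ℕ} {F : MvPolynomial n K} (hF : F.IsHomogeneous N) :
    IsClosed (hypersurface b F) := by
  rw [← isOpen_compl_iff]
  refine TopologicalSpace.isOpen_generateFrom_of_mem
    ⟨N, MvPolynomial.rename b.coord F, hF.rename_isHomogeneous, ?_⟩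
  ext x
  simp only [eval_rename_coord]
  rfl

/-- Products of forms show that the generating open sets are stable under intersection, so together
with `univ` they form a basis. -/
theorem exists_hypersurface {Z : Set (ℙ K V)} (hZ : IsClosed Z) {x : ℙ K V} (hx : x ∉ Z) :
    ∃ (N : ℕ) (F : MvPolynomial n K), F.IsHomogeneous N ∧ Z ⊆ hypersurface b F ∧
      x ∉ hypersurface b F := by
  have hbasis := TopologicalSpace.isTopologicalBasis_of_subbasis_of_inter
    (t := projZariski K V) rfl (by
      rintro _ ⟨N, p, hp, rfl⟩ _ ⟨M, q, hq, rfl⟩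
      refine ⟨N + M, p * q, hp.mul hq, ?_⟩
      ext x
      simp)
  obtain ⟨U, hU, hxU, hUZ⟩ := hbasis.exists_subset_of_mem_open (show x ∈ Zᶜ from hx) hZ.isOpen_compl
  rcases hU with rfl | ⟨N, p, hp, rfl⟩
  · refine ⟨0, 1, MvPolynomial.isHomogeneous_one _ _, fun y hy => absurd hy (hUZ trivial), ?_⟩
    simp [hypersurface]
  · refine ⟨N, toCoords b p, isHomogeneous_toCoords b hp, fun y hy => ?_, ?_⟩
    · by_contra h
      refine hUZ ?_ hy
      rw [hypersurface, Set.mem_ofPred_eq, coords, aeval_toCoords] at h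
      exact h
    · rw [hypersurface, Set.mem_ofPred_eq, coords, aeval_toCoords]
      exact hxU

/-- Affine coordinates in the chart `x_c ≠ 0`. -/
def affineCoords (c : n) (x : ℙ K V) : n → K := fun i => coords b x i / coords b x c

/-- The part of a set of points in the chart `x_c ≠ 0`. -/
def affinePart (c : n) (Z : Set (ℙ K V)) : Set (n → K) :=
  affineCoords b c '' {x ∈ Z | coords b x c ≠ 0}

theorem exists_affineCoords_eq {c : n} {y : n → K} (hy : y c = 1) :
    ∃ x : ℙ K V, coords b x c ≠ 0 ∧ affineCoords b c x = y := by
  have hw : b.equivFun.symm y ≠ 0 := by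
    rw [Ne, b.equivFun.symm.map_eq_zero_iff]
    rintro rfl
    exact zero_ne_one hy
  obtain ⟨a, ha⟩ := Projectivization.exists_smul_eq_mk_rep K _ hw
  have h : coords b (Projectivization.mk K _ hw) = (a : K) • y := by
    rw [coords, ← ha, Units.smul_def, map_smul, LinearEquiv.apply_symm_apply]
  refine ⟨Projectivization.mk K _ hw, ?_, ?_⟩
  · rw [h, Pi.smul_apply, hy, smul_eq_mul, mul_one]
    exact a.ne_zero
  · ext i
    rw [affineCoords, h, Pi.smul_apply, Pi.smul_apply, hy, smul_eq_mul, smul_eq_mul, mul_one,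
      mul_div_cancel_left₀ _ a.ne_zero]

/-- The factor `X c` disposes of the points outside the chart, so an affine condition becomes a
closed condition on all of `Z`. -/
theorem mem_vanishingIdeal_affinePart {c : n} {Z : Set (ℙ K V)} {p : MvPolynomial n K} :
    p ∈ MvPolynomial.vanishingIdeal K (affinePart b c Z) ↔
      Z ⊆ hypersurface b (MvPolynomial.X c * homogenize c p) := by
  rw [MvPolynomial.mem_vanishingIdeal_iff, affinePart, Set.forall_mem_image]
  refine forall_congr' fun x => ?_
  simp only [and_imp, hypersurface, Set.mem_ofPred_eq, map_mul,
    MvPolynomial.aeval_X, mul_eq_zero]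
  refine imp_congr_right fun _ => ?_
  by_cases h : coords b x c = 0
  · simp [h]
  · simp only [ne_eq, h, not_false_eq_true, forall_const, false_or,
      aeval_homogenize_eq_zero_iff h]
    rfl

theorem isPrime_vanishingIdeal_affinePart {c : n} {Z : Set (ℙ K V)} (hZ : IsIrreducible Z)
    (hc : ∃ x ∈ Z, coords b x c ≠ 0) :
    (MvPolynomial.vanishingIdeal K (affinePart b c Z)).IsPrime := by
  obtain ⟨x, hx, hxc⟩ := hc
  refine ⟨fun h => ?_, fun {p q} hpq => ?_⟩
  · have h1 := (Ideal.eq_top_iff_one _).1 h _ ⟨x, ⟨hx, hxc⟩, rfl⟩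
    simp at h1
  · simp only [mem_vanishingIdeal_affinePart]
    refine isPreirreducible_iff_isClosed_union_isClosed.1 hZ.isPreirreducible _ _
      (isClosed_hypersurface b (isHomogeneous_X_mul_homogenize c p))
      (isClosed_hypersurface b (isHomogeneous_X_mul_homogenize c q)) fun y hy => ?_
    by_cases hyc : coords b y c = 0
    · left; simp [hypersurface, hyc]
    · have h := hpq _ ⟨y, ⟨hy, hyc⟩, rfl⟩
      rw [map_mul, mul_eq_zero] at h
      refine h.imp ?_ ?_ <;>
      · intro h
        rw [hypersurface, Set.mem_ofPred_eq, map_mul, (aeval_homogenize_eq_zero_iff hyc _).2 h,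
          mul_zero]

/-- A form vanishing on `Z` but not on `Z'` cannot vanish on the chart part of `Z'`: otherwise its
hypersurface and the hyperplane `x_c = 0` would cover the irreducible `Z'`. -/
theorem vanishingIdeal_affinePart_lt {c : n} {Z Z' : Set (ℙ K V)} (hZ : IsClosed Z)
    (hZ' : IsIrreducible Z') (hc : ∃ x ∈ Z', coords b x c ≠ 0) (h : Z ⊂ Z') :
    MvPolynomial.vanishingIdeal K (affinePart b c Z') <
      MvPolynomial.vanishingIdeal K (affinePart b c Z) := by
  obtain ⟨hle, x, hx', hx⟩ := Set.ssubset_iff_exists.1 h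
  obtain ⟨N, F, hF, hZF, hxF⟩ := exists_hypersurface b hZ hx
  refine SetLike.lt_iff_le_and_exists.2 ⟨MvPolynomial.vanishingIdeal_anti_mono
    (Set.image_mono fun y hy => ⟨hle hy.1, hy.2⟩), F, ?_, ?_⟩
  · rintro _ ⟨y, ⟨hy, hyc⟩, rfl⟩
    exact (aeval_div_eq_zero_iff hF hyc).2 (hZF hy)
  · intro hF'
    have hcover : Z' ⊆ hypersurface b F ∪ hypersurface b (MvPolynomial.X c) := by
      intro y hy
      by_cases hyc : coords b y c = 0
      · right; simp [hypersurface, hyc]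
      · exact .inl ((aeval_div_eq_zero_iff hF hyc).1 (hF' _ ⟨y, ⟨hy, hyc⟩, rfl⟩))
    rcases isPreirreducible_iff_isClosed_union_isClosed.1 hZ'.isPreirreducible _ _
      (isClosed_hypersurface b hF)
      (isClosed_hypersurface b (MvPolynomial.isHomogeneous_X K c)) hcover with h1 | h1
    · exact hxF (h1 hx')
    · obtain ⟨y, hy, hyc⟩ := hc
      refine hyc ?_
      simpa [hypersurface] using h1 hy

/-- Chains of irreducible closed sets give chains of primes in the coordinate ring of a chart. -/
theorem le_ringKrullDim_of_ltSeries {Y : Set (ℙ K V)}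
    (s : LTSeries {Z : TopologicalSpace.IrreducibleCloseds (ℙ K V) // (Z : Set (ℙ K V)) ⊆ Y})
    {c : n} (hc : ∃ x ∈ s.head.1, coords b x c ≠ 0) {J : Ideal (MvPolynomial n K)}
    (hJ : J ≤ MvPolynomial.vanishingIdeal K (affinePart b c (s.last.1 : Set (ℙ K V)))) :
    (s.length : WithBot ℕ∞) ≤ ringKrullDim (MvPolynomial n K ⧸ J) := by
  rw [ringKrullDim_quotient]
  have hc' : ∀ i, ∃ x ∈ (s i).1, coords b x c ≠ 0 := fun i => by
    obtain ⟨x, hx, hxc⟩ := hc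
    exact ⟨x, s.monotone (Fin.zero_le i) hx, hxc⟩
  -- Vanishing ideals reverse inclusions, hence the index `i.rev`. The chart meets every member
  -- because it meets the smallest.
  let l : LTSeries (PrimeSpectrum.zeroLocus (R := MvPolynomial n K) J) :=
    LTSeries.mk s.length
      (fun i => ⟨⟨MvPolynomial.vanishingIdeal K (affinePart b c ((s i.rev).1 : Set (ℙ K V))),
        isPrime_vanishingIdeal_affinePart b (s i.rev).1.isIrreducible (hc' _)⟩, hJ.trans
          (MvPolynomial.vanishingIdeal_anti_mono (Set.image_mono fun x hx =>
            ⟨s.monotone (Fin.le_last i.rev) hx.1, hx.2⟩))⟩)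
      (fun i j hij => vanishingIdeal_affinePart_lt b (s j.rev).1.isClosed
        (s i.rev).1.isIrreducible (hc' _) (s.strictMono (Fin.rev_lt_rev.2 hij)))
  exact Order.LTSeries.length_le_krullDim l

/-- The closed irreducible set with a given prime ideal in the chart `x_c ≠ 0`. -/
theorem isIrreducible_setOf_affineCoords [IsAlgClosed K] {c : n} {q : Ideal (MvPolynomial n K)}
    (hq : q.IsPrime) (hc : MvPolynomial.X c - 1 ∈ q) :
    IsIrreducible {x : ℙ K V | coords b x c ≠ 0 ∧
      affineCoords b c x ∈ MvPolynomial.zeroLocus K q} := by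
  -- By the Nullstellensatz some zero of `q` is not a zero of `F`; `X c - 1 ∈ q` normalizes it to
  -- come from a point of the chart.
  have hpt : ∀ F ∉ q, ∃ x : ℙ K V, (coords b x c ≠ 0 ∧
      affineCoords b c x ∈ MvPolynomial.zeroLocus K q) ∧
        MvPolynomial.aeval (affineCoords b c x) F ≠ 0 := by
    intro F hF
    rw [← MvPolynomial.IsPrime.vanishingIdeal_zeroLocus (K := K) q,
      MvPolynomial.mem_vanishingIdeal_iff] at hF
    push Not at hF
    obtain ⟨y, hy, hyF⟩ := hF
    have hyc : y c = 1 := by simpa [sub_eq_zero] using hy _ hc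
    obtain ⟨x, hx, rfl⟩ := exists_affineCoords_eq b hyc
    exact ⟨x, ⟨hx, hy⟩, hyF⟩
  constructor
  · obtain ⟨x, hx, -⟩ := hpt 1 ((Ideal.ne_top_iff_one _).1 hq.ne_top)
    exact ⟨x, hx⟩
  · intro U U' hU hU' ⟨x, hx, hxU⟩ ⟨x', hx', hxU'⟩
    obtain ⟨N, F, hF, hUF, hxF⟩ := exists_hypersurface b hU.isClosed_compl (x := x) (by simpa)
    obtain ⟨N', F', hF', hUF', hxF'⟩ := exists_hypersurface b hU'.isClosed_compl (x := x') (by simpa)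
    have h1 : F ∉ q := fun h => hxF ((aeval_div_eq_zero_iff hF hx.1).1 (hx.2 _ h))
    have h2 : F' ∉ q := fun h => hxF' ((aeval_div_eq_zero_iff hF' hx'.1).1 (hx'.2 _ h))
    obtain ⟨y, hy, hyF⟩ := hpt (F * F') fun h => (hq.mem_or_mem h).elim h1 h2
    rw [map_mul, mul_ne_zero_iff] at hyF
    refine ⟨y, hy, ?_, ?_⟩
    · by_contra h
      exact hyF.1 ((aeval_div_eq_zero_iff hF hy.1).2 (hUF h))
    · by_contra h
      exact hyF.2 ((aeval_div_eq_zero_iff hF' hy.1).2 (hUF' h))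

/-- A prime above `J` goes to the closure of its zero locus in the chart. Homogenization and the
Nullstellensatz recover the prime from that closure, so strict inclusions persist. -/
theorem ringKrullDim_le_of_subset [IsAlgClosed K] {Y : Set (ℙ K V)} (hY : IsClosed Y) {c : n}
    {J : Ideal (MvPolynomial n K)} (hc : MvPolynomial.X c - 1 ∈ J)
    (hJ : ∀ (N : ℕ) (F : MvPolynomial n K), F.IsHomogeneous N → Y ⊆ hypersurface b F → F ∈ J) :
    ringKrullDim (MvPolynomial n K ⧸ J) ≤
      Order.krullDim {Z : TopologicalSpace.IrreducibleCloseds (ℙ K V) // (Z : Set (ℙ K V)) ⊆ Y} := by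
  rw [ringKrullDim_quotient, ← Order.krullDim_orderDual]
  let S : Ideal (MvPolynomial n K) → Set (ℙ K V) := fun q =>
    {x : ℙ K V | coords b x c ≠ 0 ∧ affineCoords b c x ∈ MvPolynomial.zeroLocus K q}
  refine Order.krullDim_le_of_strictMono
    (fun q : (PrimeSpectrum.zeroLocus (R := MvPolynomial n K) J)ᵒᵈ =>
      ⟨⟨closure (S (OrderDual.ofDual q).1.asIdeal), (isIrreducible_setOf_affineCoords b
        (OrderDual.ofDual q).1.2 ((OrderDual.ofDual q).2 hc)).closure, isClosed_closure⟩, ?_⟩) ?_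
  · refine hY.closure_subset_iff.2 fun x hx => ?_
    by_contra hxY
    obtain ⟨N, F, hF, hYF, hxF⟩ := exists_hypersurface b hY hxY
    exact hxF ((aeval_div_eq_zero_iff hF hx.1).1 (hx.2 _ ((OrderDual.ofDual q).2 (hJ N F hF hYF))))
  · intro q q' hlt
    have hlt' : (OrderDual.ofDual q').1.asIdeal < (OrderDual.ofDual q).1.asIdeal := hlt
    obtain ⟨hle, p, hp, hp'⟩ := SetLike.lt_iff_le_and_exists.1 hlt'
    have hmono : S (OrderDual.ofDual q).1.asIdeal ⊆ S (OrderDual.ofDual q').1.asIdeal :=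
      fun x hx => ⟨hx.1, MvPolynomial.zeroLocus_anti_mono hle hx.2⟩
    refine lt_of_le_not_ge (show closure (S _) ⊆ closure (S _) from closure_mono hmono) fun h => ?_
    have hsub : closure (S (OrderDual.ofDual q).1.asIdeal) ⊆
        hypersurface b (MvPolynomial.X c * homogenize c p) :=
      (isClosed_hypersurface b (isHomogeneous_X_mul_homogenize c p)).closure_subset_iff.2
        fun x hx => by
          rw [hypersurface, Set.mem_ofPred_eq, map_mul,
            (aeval_homogenize_eq_zero_iff hx.1 _).2 (hx.2 _ hp), mul_zero]
    have hprime := (OrderDual.ofDual q').1.2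
    refine hp' ?_
    rw [← MvPolynomial.IsPrime.vanishingIdeal_zeroLocus (K := K) (OrderDual.ofDual q').1.asIdeal,
      MvPolynomial.mem_vanishingIdeal_iff]
    intro y hy
    have hyc : y c = 1 := by
      simpa [sub_eq_zero] using hy _ ((OrderDual.ofDual q').2 hc)
    obtain ⟨x, hx, rfl⟩ := exists_affineCoords_eq b hyc
    have h1 := hsub (h (subset_closure ⟨hx, hy⟩))
    rw [hypersurface, Set.mem_ofPred_eq, map_mul, MvPolynomial.aeval_X, mul_eq_zero,
      or_iff_right hx] at h1
    exact (aeval_homogenize_eq_zero_iff hx _).1 h1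

variable {A : Type*} [CommRing A] [Algebra K A] [IsReduced A] [IsNoetherianRing A]

/-- This places `Z` in the closure of the image of one component of `Spec A`. If every minimal prime
failed, each would supply a polynomial not vanishing on `Z`; the homogenized product times `X c`,
evaluated at `f`, would lie in all minimal primes and so be zero, making the product vanish on the
chart part of `Z`, against primality. -/
theorem exists_minimalPrime_le_vanishingIdeal {Y Z : Set (ℙ K V)} (hZY : Z ⊆ Y)
    (hZ : IsIrreducible Z) {c : n} (hc : ∃ x ∈ Z, coords b x c ≠ 0) (f : n → A)
    (hf : ∀ (N : ℕ) (F : MvPolynomial n K), F.IsHomogeneous N → MvPolynomial.aeval f F = 0 →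
      Y ⊆ hypersurface b F) :
    ∃ p ∈ minimalPrimes A, f c ∉ p ∧ ∀ J : Ideal (MvPolynomial n K),
      (∀ F ∈ J, MvPolynomial.aeval f (homogenize c F) ∈ p) →
        J ≤ MvPolynomial.vanishingIdeal K (affinePart b c Z) := by
  classical
  have hprime := isPrime_vanishingIdeal_affinePart b hZ hc
  by_contra! h
  have h' : ∀ p : minimalPrimes A, ∃ F : MvPolynomial n K,
      F ∉ MvPolynomial.vanishingIdeal K (affinePart b c Z) ∧
      (f c ∉ p.1 → MvPolynomial.aeval f (homogenize c F) ∈ p.1) := by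
    rintro ⟨p, hp⟩
    by_cases hfc : f c ∈ p
    · exact ⟨1, (Ideal.ne_top_iff_one _).1 hprime.ne_top, fun h => absurd hfc h⟩
    · obtain ⟨J, hJ, hJZ⟩ := h p hp hfc
      obtain ⟨F, hF, hFZ⟩ := SetLike.not_le_iff_exists.1 hJZ
      exact ⟨F, hFZ, fun _ => hJ F hF⟩
  choose G hG hGp using h'
  have := (minimalPrimes.finite_of_isNoetherianRing A).fintype
  have hH : ∏ p, G p ∉ MvPolynomial.vanishingIdeal K (affinePart b c Z) := fun hmem => by
    obtain ⟨p, -, hp⟩ := hprime.prod_mem_iff.1 hmem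
    exact hG p hp
  refine hH ((mem_vanishingIdeal_affinePart b).2 (hZY.trans
    (hf _ _ (isHomogeneous_X_mul_homogenize c _) ?_)))
  refine IsReduced.eq_zero _ ?_
  rw [← mem_nilradical, nilradical, ← Ideal.sInf_minimalPrimes, Ideal.mem_sInf]
  intro p hp
  rw [map_mul, MvPolynomial.aeval_X]
  by_cases hfc : f c ∈ p
  · exact Ideal.mul_mem_right _ _ hfc
  refine Ideal.mul_mem_left _ _ ?_
  have : p.IsPrime := hp.1.1
  let u : A →ₐ[K] FractionRing (A ⧸ p) :=
    (IsScalarTower.toAlgHom K (A ⧸ p) _).comp (Ideal.Quotient.mkₐ K p)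
  have hu : ∀ a, u a = 0 ↔ a ∈ p := by
    intro a
    change algebraMap (A ⧸ p) (FractionRing (A ⧸ p)) (Ideal.Quotient.mk p a) = 0 ↔ _
    rw [map_eq_zero_iff _ (IsFractionRing.injective (A ⧸ p) (FractionRing (A ⧸ p))),
      Ideal.Quotient.eq_zero_iff_mem]
  rw [← hu, map_aeval_homogenize_eq_zero_iff u (mt (hu _).1 hfc), map_prod]
  refine Finset.prod_eq_zero (Finset.mem_univ ⟨p, hp⟩) ?_
  rw [← map_aeval_homogenize_eq_zero_iff u (mt (hu _).1 hfc), hu]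
  exact hGp ⟨p, hp⟩ hfc

/-- The dimension of a projective variety with generic homogeneous coordinates `f`, in terms of
its affine charts. -/
theorem projDim_eq [IsAlgClosed K] [Nontrivial A] {Y : Set (ℙ K V)} (hY : IsClosed Y) (f : n → A)
    (hf : ∀ (N : ℕ) (F : MvPolynomial n K), F.IsHomogeneous N →
      (Y ⊆ hypersurface b F ↔ MvPolynomial.aeval f F = 0))
    (hne : ∀ p ∈ minimalPrimes A, ∃ c, f c ∉ p) {d : WithBot ℕ∞}
    (hd : ∀ p ∈ minimalPrimes A, ∀ c, f c ∉ p → ∃ J : Ideal (MvPolynomial n K),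
      (∀ F, F ∈ J ↔ MvPolynomial.aeval f (homogenize c F) ∈ p) ∧
        ringKrullDim (MvPolynomial n K ⧸ J) = d) :
    projDim K Y = d := by
  refine (topologicalKrullDim_eq_of_isClosed hY).trans (le_antisymm (iSup_le fun s => ?_) ?_)
  · obtain ⟨x, hx⟩ := s.head.1.isIrreducible.nonempty
    obtain ⟨c, hc⟩ := exists_coords_ne_zero b x
    obtain ⟨p, hp, hpc, hJ⟩ := exists_minimalPrime_le_vanishingIdeal b s.last.2
      s.last.1.isIrreducible ⟨x, s.head_le_last hx, hc⟩ f fun N F hF => (hf N F hF).2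
    obtain ⟨J, hJp, rfl⟩ := hd p hp c hpc
    exact le_ringKrullDim_of_ltSeries b s ⟨x, hx, hc⟩ (hJ J fun F hF => (hJp F).1 hF)
  · obtain ⟨p, hp⟩ := Ideal.nonempty_minimalPrimes (R := A) (I := ⊥) (by simp)
    obtain ⟨c, hc⟩ := hne p hp
    obtain ⟨J, hJ, rfl⟩ := hd p hp c hc
    have : p.IsPrime := hp.1.1
    let u : A →ₐ[K] FractionRing (A ⧸ p) :=
      (IsScalarTower.toAlgHom K (A ⧸ p) _).comp (Ideal.Quotient.mkₐ K p)
    have hu : ∀ a, u a = 0 ↔ a ∈ p := by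
      intro a
      change algebraMap (A ⧸ p) (FractionRing (A ⧸ p)) (Ideal.Quotient.mk p a) = 0 ↔ _
      rw [map_eq_zero_iff _ (IsFractionRing.injective (A ⧸ p) (FractionRing (A ⧸ p))),
        Ideal.Quotient.eq_zero_iff_mem]
    have hJu : ∀ F, F ∈ J ↔ MvPolynomial.aeval (fun i => u (f i) / u (f c)) F = 0 := fun F => by
      rw [hJ, ← hu, map_aeval_homogenize_eq_zero_iff u (mt (hu _).1 hc)]
    refine ringKrullDim_le_of_subset b hY (c := c) ?_ fun N F hF hYF => ?_
    · rw [hJu, map_sub, map_one, MvPolynomial.aeval_X, div_self (mt (hu _).1 hc), sub_self]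
    · rw [hJu, aeval_div_eq_zero_iff (y := fun i => u (f i)) hF (mt (hu _).1 hc)]
      have := congrArg u ((hf N F hF).1 hYF)
      rwa [map_zero, MvPolynomial.comp_aeval_apply] at this

end Proj

/-! ### Matrix coefficients of a comodule -/

namespace GModule

variable {K A W : Type*} [Field K] [CommRing A] [HopfAlgebra K A] [AddCommGroup W] [Module K W]
  (R : GModule K A W)

/-- Matrix coefficients of a `G`-module. -/
def matCoeff (ℓ : W →ₗ[K] K) (w : W) : A := TensorProduct.lid K A (ℓ.rTensor A (R.coact w))

theorem apply_lid_rTensor (ℓ : W →ₗ[K] K) (φ : A →ₗ[K] K) (z : W ⊗[K] A) :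
    φ (TensorProduct.lid K A (ℓ.rTensor A z)) = ℓ (TensorProduct.rid K W (φ.lTensor W z)) := by
  induction z using TensorProduct.induction_on with
  | zero => simp
  | add x y hx hy => simp only [map_add, hx, hy]
  | tmul w a => simp [mul_comm]

theorem apply_matCoeff (φ : WithConv (A →ₗ[K] K)) (ℓ : W →ₗ[K] K) (w : W) :
    φ (R.matCoeff ℓ w) = ℓ (R.contract φ w) :=
  apply_lid_rTensor ℓ φ.ofConv (R.coact w)

theorem ext_lid_rTensor {z z' : W ⊗[K] A}
    (h : ∀ ℓ : W →ₗ[K] K, TensorProduct.lid K A (ℓ.rTensor A z) =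
      TensorProduct.lid K A (ℓ.rTensor A z')) : z = z' := by
  classical
  let e := Module.Basis.ofVectorSpace K W
  have key : ∀ (z : W ⊗[K] A) k, TensorProduct.equivFinsuppOfBasisLeft e z k =
      TensorProduct.lid K A ((e.coord k).rTensor A z) := by
    intro z k
    induction z using TensorProduct.induction_on with
    | zero => simp
    | add x y hx hy => simp only [map_add, Finsupp.add_apply, hx, hy]
    | tmul w a => simp
  apply (TensorProduct.equivFinsuppOfBasisLeft e).injective
  ext k
  rw [key, key, h]

variable {U : Submodule K W} {n : Type*} (b : Module.Basis n K U) (π : W →ₗ[K] U)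

/-- The matrix of a submodule of a `G`-module. -/
def matrix : Matrix n n A := Matrix.of fun i j => R.matCoeff (b.coord i ∘ₗ π) (b j)

theorem apply_matrix (φ : WithConv (A →ₗ[K] K)) (i j : n) :
    φ (R.matrix b π i j) = b.coord i (π (R.contract φ (b j))) :=
  R.apply_matCoeff _ _ _

variable [Fintype n] [IsAlgClosed K] [Algebra.FiniteType K A] [IsReduced A]

/-- Stability of `U` is known only at `K`-points; since `A` is reduced of finite type over an
algebraically closed field, equality of matrix coefficients at all points is equality in `A`. -/
theorem coact_basis (hπ : ∀ x : U, π x = x) (hU : ∀ (g : Points K A), ∀ x ∈ U, R.rep g x ∈ U)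
    (j : n) : R.coact (b j) = ∑ i, (b i : W) ⊗ₜ[K] R.matrix b π i j := by
  refine ext_lid_rTensor fun ℓ => ?_
  rw [← sub_eq_zero]
  refine eq_zero_of_forall_algHom (K := K) fun g => ?_
  rw [map_sub, sub_eq_zero]
  let φ : WithConv (A →ₗ[K] K) := Points.ev (WithConv.toConv g)
  have h1 : g (TensorProduct.lid K A (ℓ.rTensor A (R.coact (b j)))) =
      ℓ (R.contract φ (b j)) := R.apply_matCoeff φ ℓ (b j)
  have hg : ∀ i, g (R.matrix b π i j) = b.coord i (π (R.contract φ (b j))) :=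
    fun i => R.apply_matrix b π φ i j
  have hmem : R.contract φ (b j) ∈ U := hU (WithConv.toConv g) _ (b j).2
  have hpi : π (R.contract φ (b j)) = ⟨_, hmem⟩ := hπ ⟨_, hmem⟩
  have hsum := congrArg (Subtype.val) (b.sum_repr ⟨_, hmem⟩)
  rw [h1]
  simp only [map_sum, LinearMap.rTensor_tmul, TensorProduct.lid_tmul, map_smul, hg, hpi]
  refine (congrArg ℓ hsum.symm).trans ?_
  simp [-Module.Basis.sum_repr, mul_comm]

theorem isMultiplicative_matrix [DecidableEq n] (hπ : ∀ x : U, π x = x)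
    (hU : ∀ (g : Points K A), ∀ x ∈ U, R.rep g x ∈ U) :
    IsMultiplicative (K := K) (R.matrix b π) := by
  constructor
  · intro i j
    have hco := LinearMap.congr_fun R.coassoc (b j : W)
    simp only [LinearMap.comp_apply, LinearEquiv.coe_coe] at hco
    have h := congrArg (fun z => TensorProduct.lid K (A ⊗[K] A)
      ((b.coord i ∘ₗ π).rTensor (A ⊗[K] A) z)) hco
    have key : ∀ (x : W ⊗[K] A) (a : A), TensorProduct.lid K (A ⊗[K] A)
        ((b.coord i ∘ₗ π).rTensor (A ⊗[K] A) (TensorProduct.assoc K W A A (x ⊗ₜ a))) =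
        TensorProduct.lid K A ((b.coord i ∘ₗ π).rTensor A x) ⊗ₜ[K] a := by
      intro x a
      induction x using TensorProduct.induction_on with
      | zero => simp
      | add x y hx hy => simp only [TensorProduct.add_tmul, map_add, hx, hy]
      | tmul w a => simp [TensorProduct.smul_tmul']
    rw [R.coact_basis b π hπ hU j] at h
    simp only [map_sum, LinearMap.rTensor_tmul, LinearMap.lTensor_tmul, key] at h
    refine Eq.trans ?_ h.symm
    simp [hπ, Finsupp.single_apply]
  · intro i j
    have h := R.apply_matrix b π 1 i j
    rw [contract_one, LinearMap.id_apply, hπ, LinearMap.convOne_apply] at h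
    refine Eq.trans h ?_
    rw [Module.Basis.coord_apply, b.repr_self, Finsupp.single_apply]
    exact if_congr eq_comm rfl rfl

end GModule

/-! ### Projective dimension of orbit closures -/

section Orbit

variable {K A V n : Type*} [Field K] [CommRing A] [HopfAlgebra K A] [AddCommGroup V] [Module K V]
  [Fintype n] (b : Module.Basis n K V)

theorem isClosed_setOf_aeval_eq_zero (F : MvPolynomial n K) :
    @IsClosed V (zariski K V) {w | MvPolynomial.aeval (b.equivFun w) F = 0} := by
  let := zariski K V
  rw [← isOpen_compl_iff]
  refine TopologicalSpace.isOpen_generateFrom_of_mem ⟨MvPolynomial.rename b.coord F, ?_⟩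
  ext w
  simp only [eval_rename_coord]
  rfl

variable [DecidableEq n] {ρ : Matrix n n A} {o : n}

/-- A column of an invertible matrix generates the unit ideal. -/
theorem IsMultiplicative.exists_apply_notMem (hρ : IsMultiplicative (K := K) ρ) (o : n)
    {p : Ideal A} (hp : p ≠ ⊤) : ∃ c, ρ c o ∉ p := by
  by_contra! h
  have h1 := hρ.sum_inv_mul (WithConv.toConv (AlgHom.id K A)) o o
  rw [if_pos rfl] at h1
  refine hp ((Ideal.eq_top_iff_one p).2 ?_)
  rw [← h1]
  exact sum_mem fun k _ => p.mul_mem_left _ (h k)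

theorem exists_chartIdeal [CharZero K] [Algebra.FiniteType K A] [IsReduced A]
    (hρ : IsMultiplicative (K := K) ρ) {p : Ideal A} (hp : p ∈ minimalPrimes A) {c : n} (hc : ρ c o ∉ p) :
    ∃ (J : Ideal (MvPolynomial n K)) (d : ℕ),
      (∀ F, F ∈ J ↔ MvPolynomial.aeval (fun i => ρ i o) (homogenize c F) ∈ p) ∧
      ringKrullDim (MvPolynomial n K ⧸ J) = d ∧
      (Pi.single o 1 ∈ lieVec K ρ o → d + 1 = Module.finrank K (lieVec K ρ o)) ∧
      (Pi.single o 1 ∉ lieVec K ρ o → d = Module.finrank K (lieVec K ρ o)) := by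
  have hpp : p.IsPrime := hp.1.1
  let L := Localization.AtPrime p
  -- A reduced local ring of dimension zero is a field; being a localization, it is formally étale
  -- over `A`, so invariant derivations extend to it.
  have : Ring.KrullDimLE 0 L := Ring.KrullDimLE.of_isLocalization p hp L
  let : Field L := (Ring.KrullDimLE.isField_of_isReduced (R := L)).toField
  have : Algebra.FormallyEtale A L := Algebra.FormallyEtale.of_isLocalization p.primeCompl
  have hu : ∀ a : A, algebraMap A L a = 0 ↔ a ∈ p := by
    intro a
    rw [← not_iff_not]
    exact (isUnit_iff_ne_zero).symm.trans (IsLocalization.AtPrime.isUnit_to_map_iff L p a)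
  obtain ⟨h1, h2⟩ := finrank_range_evalDer_chart (L := L) hρ (mt (hu _).1 hc)
  refine ⟨_, _, fun F => ?_,
    ringKrullDim_quotient_ker_aeval fun i => algebraMap A L (ρ i o) / algebraMap A L (ρ c o),
    h1, h2⟩
  rw [RingHom.mem_ker, ← hu]
  exact (map_aeval_homogenize_eq_zero_iff (f := fun i => ρ i o) (IsScalarTower.toAlgHom K A L)
    (mt (hu _).1 hc) F).symm

variable [IsAlgClosed K] [Algebra.FiniteType K A] {O : Set V}

theorem isConical_iff_single_mem_lieVec [CharZero K] (hρ : IsMultiplicative (K := K) ρ)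
    (hO : ∀ w, w ∈ O ↔ ∃ g : Points K A, ∀ i, b.equivFun w i = g (ρ i o)) :
    IsConical (K := K) O ↔ Pi.single o 1 ∈ lieVec K ρ o := by
  have hbo : b o ∈ O := (hO _).2 ⟨1, fun i => by
    rw [hρ.one_apply, b.equivFun_self]
    exact if_congr eq_comm rfl rfl⟩
  constructor
  · refine fun h => single_mem_lieVec hρ fun c hc => ?_
    obtain ⟨g, hg⟩ := (hO _).1 (h c hc _ hbo)
    refine ⟨g, fun k => ?_⟩
    rw [← hg, map_smul, Pi.smul_apply, b.equivFun_self, Pi.single_apply, smul_eq_mul, mul_ite,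
      mul_one, mul_zero]
    exact if_congr eq_comm rfl rfl
  · intro h c hc x hx
    obtain ⟨g, hg⟩ := (hO _).1 hx
    obtain ⟨s, hs⟩ := exists_point_of_single_mem_lieVec hρ h c hc
    -- The point `s` scales `e_o` by `c`, and `g` moves `c • e_o` to `c • x`.
    refine (hO _).2 ⟨g * s, fun i => ?_⟩
    rw [hρ.algHom_convMul_apply, map_smul, Pi.smul_apply, hg, Finset.sum_eq_single o]
    · rw [hs, Pi.single_eq_same, smul_eq_mul, mul_comm]
    · intro k _ hk
      rw [hs, Pi.single_eq_of_ne hk, mul_zero]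
    · simp

variable [IsReduced A]

/-- Vanishing on the orbit passes to both closures, and a regular function vanishing at all points
of `G` is zero. Thus column `o` of `ρ` serves as generic homogeneous coordinates. -/
theorem projVariety_subset_hypersurface_iff (hρ : IsMultiplicative (K := K) ρ)
    (hO : ∀ w, w ∈ O ↔ ∃ g : Points K A, ∀ i, b.equivFun w i = g (ρ i o)) {N : ℕ}
    {F : MvPolynomial n K} (hF : F.IsHomogeneous N) :
    projVariety K (zariskiClosure K O) ⊆ hypersurface b F ↔
      MvPolynomial.aeval (fun i => ρ i o) F = 0 := by
  constructor
  · intro h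
    refine eq_zero_of_forall_algHom (K := K) fun φ => ?_
    let w : V := b.equivFun.symm fun i => φ (ρ i o)
    have hw : ∀ i, b.equivFun w i = φ (ρ i o) := fun i => by
      rw [LinearEquiv.apply_symm_apply]
    have hw0 : w ≠ 0 := by
      intro h0
      have h1 := hρ.sum_inv_mul (WithConv.toConv φ) o o
      rw [if_pos rfl] at h1
      refine zero_ne_one (h1.symm.trans (Finset.sum_eq_zero fun k _ => ?_)).symm
      rw [show (WithConv.toConv φ) (ρ k o) = 0 by
        refine (hw k).symm.trans ?_; rw [h0, map_zero, Pi.zero_apply], mul_zero]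
    have hmem : Projectivization.mk K w hw0 ∈ projVariety K (zariskiClosure K O) :=
      @subset_closure _ (projZariski K V) _ _
        ⟨w, hw0, @subset_closure _ (zariski K V) _ _ ((hO w).2 ⟨WithConv.toConv φ, hw⟩), rfl⟩
    have h2 := (aeval_coords_mk b hF w hw0).1 (h hmem)
    rw [funext hw] at h2
    rwa [MvPolynomial.comp_aeval_apply]
  · intro h
    refine @closure_minimal _ (projZariski K V) _ _ ?_ (isClosed_hypersurface b hF)
    rintro _ ⟨w, hw, hwO, rfl⟩
    refine (aeval_coords_mk b hF w hw).2 ?_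
    refine (@closure_minimal _ (zariski K V) _ _ ?_ (isClosed_setOf_aeval_eq_zero b F) :
      zariskiClosure K O ⊆ _) hwO
    intro x hx
    obtain ⟨g, hg⟩ := (hO x).1 hx
    change MvPolynomial.aeval (b.equivFun x) F = 0
    rw [funext hg]
    have := congrArg g.ofConv h
    rwa [map_zero, MvPolynomial.comp_aeval_apply] at this

theorem finrank_lieVec_eq_projDim [CharZero K] (hρ : IsMultiplicative (K := K) ρ)
    (hO : ∀ w, w ∈ O ↔ ∃ g : Points K A, ∀ i, b.equivFun w i = g (ρ i o)) :
    (Pi.single o 1 ∈ lieVec K ρ o → ((Module.finrank K (lieVec K ρ o) : ℕ) : WithBot ℕ∞) =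
      projDim K (projVariety K (zariskiClosure K O)) + 1) ∧
    (Pi.single o 1 ∉ lieVec K ρ o → ((Module.finrank K (lieVec K ρ o) : ℕ) : WithBot ℕ∞) =
      projDim K (projVariety K (zariskiClosure K O))) := by
  have : Nontrivial A := (Bialgebra.counitAlgHom K A).toRingHom.domain_nontrivial
  have : IsNoetherianRing A := Algebra.FiniteType.isNoetherianRing K A
  have key := fun d => projDim_eq (d := d) b (Y := projVariety K (zariskiClosure K O))
    (@isClosed_closure _ (projZariski K V) _) (fun i => ρ i o)
    (fun N F hF => projVariety_subset_hypersurface_iff b hρ hO hF)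
    fun p hp => hρ.exists_apply_notMem o hp.1.1.ne_top
  constructor
  · intro h
    -- The truncated subtraction is harmless: `lieVec` contains the nonzero vector `e_o`.
    rw [key ((Module.finrank K (lieVec K ρ o) - 1 : ℕ) : WithBot ℕ∞)]
    · have : 0 < Module.finrank K (lieVec K ρ o) := by
        refine Module.finrank_pos_iff_exists_ne_zero.2 ⟨⟨_, h⟩, fun h0 => ?_⟩
        simpa using congrFun (congrArg Subtype.val h0) o
      rw [← Nat.sub_add_cancel this, Nat.add_sub_cancel]
      push_cast
      rfl
    · intro p hp c hc
      obtain ⟨J, d, hJ, hd, h1, -⟩ := exists_chartIdeal hρ hp hc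
      exact ⟨J, hJ, by rw [hd, ← h1 h, Nat.add_sub_cancel]⟩
  · intro h
    refine (key _ fun p hp c hc => ?_).symm
    obtain ⟨J, d, hJ, hd, -, h2⟩ := exists_chartIdeal hρ hp hc
    exact ⟨J, hJ, by rw [hd, ← h2 h]⟩

end Orbit

/-! ### From the graded algebra to matrices -/

theorem exists_basis_apply_eq {K V : Type*} [Field K] [AddCommGroup V] [Module K V]
    [FiniteDimensional K V] {v : V} (hv : v ≠ 0) :
    ∃ (N : ℕ) (b : Module.Basis (Fin N) K V) (o : Fin N), b o = v := by
  have hli : LinearIndepOn K id {v} := LinearIndepOn.singleton (v := id) hv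
  let b := Module.Basis.extend hli
  have := FiniteDimensional.fintypeBasisIndex b
  refine ⟨_, b.reindex (Fintype.equivFin _),
    Fintype.equivFin _ ⟨v, hli.subset_extend _ rfl⟩, ?_⟩
  rw [Module.Basis.reindex_apply, Equiv.symm_apply_apply]
  exact Module.Basis.extend_apply_self hli _

namespace GradedExtension

variable {K A : Type*} [Field K] [CommRing A] [HopfAlgebra K A] {m : ℕ}
  {𝔞 : Type*} [AddCommGroup 𝔞] [Module K 𝔞] (𝒜 : ZMod m → Submodule K 𝔞)
  [DirectSum.Decomposition 𝒜]

/-- The projection onto a graded piece. -/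
def proj (i : ZMod m) : 𝔞 →ₗ[K] 𝒜 i :=
  DirectSum.component K (ZMod m) (fun l => 𝒜 l) i ∘ₗ
    (DirectSum.decomposeLinearEquiv 𝒜).toLinearMap

theorem proj_coe (i : ZMod m) (x : 𝒜 i) : proj 𝒜 i x = x := by
  simp [proj]

variable {𝒜} (E : GradedExtension K A 𝒜) {n : Type*} [Fintype n] (b : Module.Basis n K (𝒜 1))

/-- The bracket `[b o, X]` is `-X.(b o)`; replacing `X` by `-X` absorbs the sign. -/
theorem map_range_block (o : n) : (LinearMap.range (E.block 1 0 1 (b o))).map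
      b.equivFun.toLinearMap = lieVec K (E.gmod.matrix b (proj 𝒜 1)) o := by
  have h : ∀ X k, b.equivFun (E.block 1 0 1 (b o) (E.ident X)) k =
      -X.1 (E.gmod.matrix b (proj 𝒜 1) k o) := by
    intro X k
    change b.coord k (proj 𝒜 1 (E.bracket (b o) (E.ident X))) = _
    rw [E.bracket_right X _ (b o).2, map_neg, map_neg, E.gmod.apply_matrix]
    rfl
  ext w
  rw [mem_lieVec]
  constructor
  · rintro ⟨_, ⟨Y, rfl⟩, rfl⟩
    obtain ⟨X, rfl⟩ := E.ident.surjective Y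
    refine ⟨-X, fun k => ?_⟩
    exact (h X k).symm
  · rintro ⟨X, hX⟩
    refine ⟨_, ⟨E.ident (-X), rfl⟩, funext fun k => ?_⟩
    refine (h (-X) k).trans (Eq.trans ?_ (hX k))
    exact neg_neg (X.1 (E.gmod.matrix b (proj 𝒜 1) k o))

theorem mem_orbit_iff (o : n) (w : 𝒜 1) : w ∈ E.orbit (b o) ↔
    ∃ g : Points K A, ∀ i, b.equivFun w i = g (E.gmod.matrix b (proj 𝒜 1) i o) := by
  refine exists_congr fun g => ?_
  have hg : ∀ i, g (E.gmod.matrix b (proj 𝒜 1) i o) =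
      b.equivFun (proj 𝒜 1 (E.gmod.rep g (b o))) i :=
    fun i => E.gmod.apply_matrix b (proj 𝒜 1) g.ev i o
  simp only [hg]
  rw [← funext_iff, b.equivFun.injective.eq_iff, Subtype.ext_iff]
  have h := proj_coe 𝒜 1 ⟨_, E.stable g 1 _ (b o).2⟩
  rw [h]

end GradedExtension

end AdjointRank
end

/-! ### The rank formula -/

open AdjointRank in
theorem mainTheorem7 {K A : Type*} [Field K] [IsAlgClosed K] [CharZero K]
    [CommRing A] [HopfAlgebra K A] [Algebra.FiniteType K A] [IsReduced A]
    {m : ℕ} (hm : m ≠ 1) {𝔞 : Type*} [AddCommGroup 𝔞] [Module K 𝔞] [FiniteDimensional K 𝔞]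
    (𝒜 : ZMod m → Submodule K 𝔞) [DirectSum.Decomposition 𝒜]
    (E : GradedExtension K A 𝒜) (T : 𝒜 1) (hT : T ≠ 0) :
    (IsConical (K := K) (E.orbit T) →
      ((Module.finrank K (LinearMap.range (E.block 1 0 1 T)) : ℕ) : WithBot ℕ∞) =
        projDim K (projVariety K (zariskiClosure K (E.orbit T))) + 1) ∧
    (¬ IsConical (K := K) (E.orbit T) →
      ((Module.finrank K (LinearMap.range (E.block 1 0 1 T)) : ℕ) : WithBot ℕ∞) =
        projDim K (projVariety K (zariskiClosure K (E.orbit T)))) := by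
  -- With `T` a basis vector, its orbit and `𝔤.T` are both read off column `o` of one matrix.
  obtain ⟨N, b, o, rfl⟩ := exists_basis_apply_eq (K := K) hT
  have hρ := E.gmod.isMultiplicative_matrix b (GradedExtension.proj 𝒜 1)
    (GradedExtension.proj_coe 𝒜 1) fun g x hx => E.stable g 1 x hx
  have hO := E.mem_orbit_iff b o
  have hrank : Module.finrank K (LinearMap.range (E.block 1 0 1 (b o))) =
      Module.finrank K (lieVec K (E.gmod.matrix b (GradedExtension.proj 𝒜 1)) o) := by
    rw [← E.map_range_block b o]
    exact (LinearEquiv.finrank_map_eq b.equivFun _).symm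
  rw [hrank, isConical_iff_single_mem_lieVec b hρ hO]
  exact finrank_lieVec_eq_projDim b hρ hO
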